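/- Let $n\ge 0$ be an integer. Let $\mathcal D(\mathbb R^n)$ be the space of compactly supported smooth functions and $\mathcal D'(\mathbb R^n)$ the space of (complex-valued) distributions; for $h\in\mathbb R^n$ write $T_{h}f=f(\,\cdot\,-h)$, that is, $\langle T_{h}f,\varphi\rangle=\langle f,T_{-h}\varphi\rangle$. Let $\mathcal K_1(\mathbb R^n)$ be the space of all $\varphi\in C^\infty(\mathbb R^n)$ such that $\nu_k(\varphi)=\sup_{t\in\mathbb R^n,\,|\alpha|\le k}e^{k|t|}|\varphi^{(\alpha)}(t)|<\infty$ for every $k\in\mathbb N_0$, with the topology given by the norms $\nu_k$, and let $\mathcal K_1'(\mathbb R^n)$ be its dual. An exponentially moderate weight is a measurable function $\omega:\mathbb R^n\to(0,\infty)$ such that, for some constants $A>0$ and $a\ge 0$, $\omega(x+y)\le A\,\omega(y)e^{a|x|}$ for all $x,y\in\mathbb R^n$. For such $\omega$ let $\mathcal D_{L^1_\omega}(\mathbb R^n)$ be the space of all $\varphi\in C^\infty(\mathbb R^n)$ such that $\int_{\mathbb R^n}|\varphi^{(\alpha)}(t)|\,\omega(t)\,dt<\infty$ for all $\alpha\in\mathbb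 N_0^n$, with the topology given by the norms $\|\varphi\|_{1,\omega,k}=\sup_{|\alpha|\le k}\int_{\mathbb R^n}|\varphi^{(\alpha)}(t)|\,\omega(t)\,dt$, $k\in\mathbb N_0$. Let $\mathcal B'_\omega(\mathbb R^n)$ be the strong dual of $\mathcal D_{L^1_\omega}(\mathbb R^n)$, and let $\dot{\mathcal B}'_\omega(\mathbb R^n)$ be the closure of $\mathcal D(\mathbb R^n)$ in $\mathcal B'_\omega(\mathbb R^n)$, where $\phi\in\mathcal D(\mathbb R^n)$ is identified with the functional $\chi\mapsto\int_{\mathbb R^n}\phi(t)\chi(t)\,dt$. The spaces $\mathcal K_1'(\mathbb R^n)$, $\mathcal B'_\omega(\mathbb R^n)$ and $\dot{\mathcal B}'_\omega(\mathbb R^n)$ are regarded as subsets of $\mathcal D'(\mathbb R^n)$ by restricting functionals to $\mathcal D(\mathbb R^n)$. Then $$\mathcal K_1'(\mathbb R^n)=\bigcup_\omega\mathcal B'_\omega(\mathbb R^n)=\bigcup_\omega\dot{\mathcal B}'_\omega(\mathbb R^n),$$ where the unions are taken over all exponentially moderate weights $\omega$. Moreover, a distribution $f\in\mathcal D'(\mathbb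 R^n)$ belongs to $\mathcal K_1'(\mathbb R^n)$ if and only if there is $s\in\mathbb R$ such that the set $\{e^{-s|h|}T_{-h}f:\ h\in\mathbb R^n\}$ is bounded in $\mathcal D'(\mathbb R^n)$. -/

import Mathlib

open MeasureTheory TopologicalSpace Bornology
open scoped Distributions

namespace ExpType

/-- The Euclidean space `ℝⁿ`. -/
abbrev Rn (n : ℕ) : Type := EuclideanSpace ℝ (Fin n)

/-! ### The test function space `K₁(ℝⁿ)` -/

/-- The exponentially rapidly decreasing smooth functions, as a complex vector space: those
`φ ∈ C^∞(ℝⁿ)` such that `e^{k|t|} |D^j φ(t)|` is bounded in `t` for all `k` and `j`. Here `D^j φ(t)`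
is the `j`-th Fréchet derivative, whose norm is comparable with `max_{|α| = j} |φ^{(α)}(t)|`. -/
noncomputable def K1Submodule (n : ℕ) : Submodule ℂ (Rn n → ℂ) where
  carrier := {φ | ContDiff ℝ (⊤ : ℕ∞) φ ∧ ∀ k j : ℕ, ∃ C : ℝ, ∀ t : Rn n,
    Real.exp (k * ‖t‖) * ‖iteratedFDeriv ℝ j φ t‖ ≤ C}
  zero_mem' := by
    refine ⟨contDiff_const, fun k j => ⟨0, fun t => ?_⟩⟩
    have h : iteratedFDeriv ℝ j (0 : Rn n → ℂ) = 0 := iteratedFDeriv_fun_zero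
    simp [h]
  add_mem' := by
    rintro f g ⟨hf, hf'⟩ ⟨hg, hg'⟩
    refine ⟨hf.add hg, fun k j => ?_⟩
    obtain ⟨C, hC⟩ := hf' k j
    obtain ⟨D, hD⟩ := hg' k j
    refine ⟨C + D, fun t => ?_⟩
    rw [iteratedFDeriv_add_apply (hf.of_le (mod_cast le_top)).contDiffAt
      (hg.of_le (mod_cast le_top)).contDiffAt]
    calc _ ≤ Real.exp (k * ‖t‖) * (‖iteratedFDeriv ℝ j f t‖ + ‖iteratedFDeriv ℝ j g t‖) := by
          gcongr; exact norm_add_le _ _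
      _ ≤ C + D := by rw [mul_add]; exact add_le_add (hC t) (hD t)
  smul_mem' := by
    rintro c f ⟨hf, hf'⟩
    refine ⟨hf.const_smul c, fun k j => ?_⟩
    obtain ⟨C, hC⟩ := hf' k j
    refine ⟨‖c‖ * C, fun t => ?_⟩
    rw [iteratedFDeriv_const_smul_apply (hf.of_le (mod_cast le_top)).contDiffAt, norm_smul,
      mul_left_comm]
    exact mul_le_mul_of_nonneg_left (hC t) (norm_nonneg c)

/-- The space `K₁(ℝⁿ)`. This is a type of its own and not the coercion of the submodule, because it
does not carry the topology of pointwise convergence. -/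
def K1 (n : ℕ) : Type := K1Submodule n

namespace K1

variable {n : ℕ}

noncomputable instance : AddCommGroup (K1 n) := inferInstanceAs (AddCommGroup (K1Submodule n))

noncomputable instance : Module ℂ (K1 n) := inferInstanceAs (Module ℂ (K1Submodule n))

instance : CoeFun (K1 n) fun _ => Rn n → ℂ := ⟨fun φ => φ.1⟩

/-- The seminorm `φ ↦ sup_t e^{k|t|} |D^j φ(t)|`. -/
noncomputable def weightedSup (n k j : ℕ) : Seminorm ℂ (K1 n) :=
  have bdd (φ : K1 n) : BddAbove
      (Set.range fun t : Rn n => Real.exp (k * ‖t‖) * ‖iteratedFDeriv ℝ j φ t‖) := by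
    obtain ⟨C, hC⟩ := φ.2.2 k j
    exact ⟨C, by rintro _ ⟨t, rfl⟩; exact hC t⟩
  Seminorm.of (fun φ => ⨆ t : Rn n, Real.exp (k * ‖t‖) * ‖iteratedFDeriv ℝ j φ t‖)
    (fun φ χ => by
      refine ciSup_le fun t => ?_
      have h : iteratedFDeriv ℝ j (φ + χ : K1 n) t
          = iteratedFDeriv ℝ j φ t + iteratedFDeriv ℝ j χ t :=
        iteratedFDeriv_add_apply (φ.2.1.of_le (mod_cast le_top)).contDiffAt
          (χ.2.1.of_le (mod_cast le_top)).contDiffAt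
      calc Real.exp (k * ‖t‖) * ‖iteratedFDeriv ℝ j (φ + χ : K1 n) t‖
          ≤ Real.exp (k * ‖t‖) * (‖iteratedFDeriv ℝ j φ t‖ + ‖iteratedFDeriv ℝ j χ t‖) := by
            rw [h]; gcongr; exact norm_add_le _ _
        _ ≤ _ := by
            rw [mul_add]
            exact add_le_add (le_ciSup (bdd φ) t) (le_ciSup (bdd χ) t))
    (fun c φ => by
      rw [Real.mul_iSup_of_nonneg (norm_nonneg c)]
      refine iSup_congr fun t => ?_
      have h : iteratedFDeriv ℝ j (c • φ : K1 n) t = c • iteratedFDeriv ℝ j φ t :=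
        iteratedFDeriv_const_smul_apply (φ.2.1.of_le (mod_cast le_top)).contDiffAt
      rw [h, norm_smul, mul_left_comm])

/-- The norms `ν_k(φ) = sup_{t, j ≤ k} e^{k|t|} |D^j φ(t)|`. -/
noncomputable def nu (n : ℕ) : SeminormFamily ℂ (K1 n) ℕ :=
  fun k => (Finset.range (k + 1)).sup fun j => weightedSup n k j

/-- The Fréchet topology of `K₁(ℝⁿ)`, generated by the norms `ν_k`. -/
noncomputable instance : TopologicalSpace (K1 n) := (nu n).moduleFilterBasis.topology

theorem withSeminorms (n : ℕ) : WithSeminorms (nu n) := ⟨rfl⟩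

/-- A real test function, regarded as an element of `K₁(ℝⁿ)`. -/
noncomputable def ofTest (φ : 𝓓((⊤ : Opens (Rn n)), ℝ)) : K1 n :=
  ⟨fun t => (φ t : ℂ), by
    have h1 : ContDiff ℝ (⊤ : ℕ∞) fun t => (φ t : ℂ) := Complex.ofRealCLM.contDiff.comp φ.contDiff
    have h2 : HasCompactSupport fun t => (φ t : ℂ) :=
      φ.hasCompactSupport.comp_left Complex.ofReal_zero
    refine ⟨h1, fun k j => ?_⟩
    have h3 : Continuous (iteratedFDeriv ℝ j fun t => (φ t : ℂ)) :=
      h1.continuous_iteratedFDeriv (mod_cast le_top)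
    obtain ⟨C, hC⟩ := ((h2.iteratedFDeriv (𝕜 := ℝ) j).norm.mul_left
      (f := fun t : Rn n => Real.exp (k * ‖t‖))).exists_bound_of_continuous (by fun_prop)
    exact ⟨C, fun t => (le_abs_self _).trans (hC t)⟩⟩

end K1

/-! ### Exponentially moderate weights and the spaces `D_{L¹_ω}(ℝⁿ)` -/

/-- An exponentially moderate weight on `ℝⁿ`: a measurable function `ω : ℝⁿ → (0, ∞)` with
`ω(x + y) ≤ A ω(y) e^{a|x|}` for some constants `A > 0` and `a ≥ 0`. -/
structure Weight (n : ℕ) where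
  toFun : Rn n → ℝ
  measurable' : Measurable toFun
  pos' : ∀ x, 0 < toFun x
  moderate' : ∃ A a : ℝ, 0 < A ∧ 0 ≤ a ∧
    ∀ x y, toFun (x + y) ≤ A * toFun y * Real.exp (a * ‖x‖)

instance (n : ℕ) : CoeFun (Weight n) fun _ => Rn n → ℝ := ⟨Weight.toFun⟩

/-- The measure `ω(t) dt`, so that `L¹_ω` is `L¹` of this measure. -/
noncomputable def Weight.measure {n : ℕ} (ω : Weight n) : Measure (Rn n) :=
  volume.withDensity fun t => ENNReal.ofReal (ω t)

theorem Weight.isLocallyFiniteMeasure {n : ℕ} (ω : Weight n) :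
    IsLocallyFiniteMeasure ω.measure := by
  obtain ⟨A, a, -, -, h⟩ := ω.moderate'
  have h1 : IsLocallyFiniteMeasure ((volume : Measure (Rn n)).withDensity
      fun t => ENNReal.ofReal (A * ω 0 * Real.exp (a * ‖t‖))) :=
    IsLocallyFiniteMeasure.withDensity_ofReal (by fun_prop)
  have h2 : ω.measure ≤ (volume : Measure (Rn n)).withDensity
      fun t => ENNReal.ofReal (A * ω 0 * Real.exp (a * ‖t‖)) :=
    withDensity_mono (ae_of_all _ fun t => ENNReal.ofReal_le_ofReal (by simpa using h t 0))
  exact Measure.isLocallyFiniteMeasure_of_le h2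

/-- The smooth functions all of whose derivatives belong to `L¹_ω`, as a complex vector space. -/
noncomputable def DL1Submodule {n : ℕ} (ω : Weight n) : Submodule ℂ (Rn n → ℂ) where
  carrier := {φ | ContDiff ℝ (⊤ : ℕ∞) φ ∧ ∀ j : ℕ, Integrable (iteratedFDeriv ℝ j φ) ω.measure}
  zero_mem' := by
    refine ⟨contDiff_const, fun j => ?_⟩
    have h : iteratedFDeriv ℝ j (0 : Rn n → ℂ) = 0 := iteratedFDeriv_fun_zero
    rw [h]
    exact integrable_zero _ _ _
  add_mem' := by
    rintro f g ⟨hf, hf'⟩ ⟨hg, hg'⟩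
    refine ⟨hf.add hg, fun j => ?_⟩
    rw [iteratedFDeriv_add (hf.of_le (mod_cast le_top)) (hg.of_le (mod_cast le_top))]
    exact (hf' j).add (hg' j)
  smul_mem' := by
    rintro c f ⟨hf, hf'⟩
    refine ⟨hf.const_smul c, fun j => ?_⟩
    have h : iteratedFDeriv ℝ j (c • f) = c • iteratedFDeriv ℝ j f := by
      ext1 t
      exact iteratedFDeriv_const_smul_apply (hf.of_le (mod_cast le_top)).contDiffAt
    rw [h]
    exact (hf' j).smul c

/-- The space `D_{L¹_ω}(ℝⁿ)`. -/
def DL1 {n : ℕ} (ω : Weight n) : Type := DL1Submodule ω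

namespace DL1

variable {n : ℕ} {ω : Weight n}

noncomputable instance : AddCommGroup (DL1 ω) := inferInstanceAs (AddCommGroup (DL1Submodule ω))

noncomputable instance : Module ℂ (DL1 ω) := inferInstanceAs (Module ℂ (DL1Submodule ω))

instance : CoeFun (DL1 ω) fun _ => Rn n → ℂ := ⟨fun φ => φ.1⟩

/-- The seminorm `φ ↦ ∫ |D^j φ(t)| ω(t) dt`. -/
noncomputable def weightedInt (ω : Weight n) (j : ℕ) : Seminorm ℂ (DL1 ω) :=
  Seminorm.of (fun φ => ∫ t, ‖iteratedFDeriv ℝ j φ t‖ ∂ω.measure)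
    (fun φ χ => by
      rw [← integral_add (φ.2.2 j).norm (χ.2.2 j).norm]
      refine integral_mono ((φ + χ : DL1 ω).2.2 j).norm
        ((φ.2.2 j).norm.add (χ.2.2 j).norm) fun t => ?_
      have h : iteratedFDeriv ℝ j (φ + χ : DL1 ω) t
          = iteratedFDeriv ℝ j φ t + iteratedFDeriv ℝ j χ t :=
        iteratedFDeriv_add_apply (φ.2.1.of_le (mod_cast le_top)).contDiffAt
          (χ.2.1.of_le (mod_cast le_top)).contDiffAt
      change ‖iteratedFDeriv ℝ j (φ + χ : DL1 ω) t‖ ≤ _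
      rw [h]
      exact norm_add_le _ _)
    (fun c φ => by
      rw [← integral_const_mul]
      refine integral_congr_ae (ae_of_all _ fun t => ?_)
      have h : iteratedFDeriv ℝ j (c • φ : DL1 ω) t = c • iteratedFDeriv ℝ j φ t :=
        iteratedFDeriv_const_smul_apply (φ.2.1.of_le (mod_cast le_top)).contDiffAt
      change ‖iteratedFDeriv ℝ j (c • φ : DL1 ω) t‖ = _
      rw [h, norm_smul])

/-- The norms `‖φ‖_{1,ω,k} = sup_{j ≤ k} ∫ |D^j φ(t)| ω(t) dt`. -/
noncomputable def norms (ω : Weight n) : SeminormFamily ℂ (DL1 ω) ℕ :=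
  fun k => (Finset.range (k + 1)).sup fun j => weightedInt ω j

/-- The Fréchet topology of `D_{L¹_ω}(ℝⁿ)`, generated by the norms `‖·‖_{1,ω,k}`. -/
noncomputable instance : TopologicalSpace (DL1 ω) := (norms ω).moduleFilterBasis.topology

theorem withSeminorms (ω : Weight n) : WithSeminorms (norms ω) := ⟨rfl⟩

/-- A real test function, regarded as an element of `D_{L¹_ω}(ℝⁿ)`. -/
noncomputable def ofTest (ω : Weight n) (φ : 𝓓((⊤ : Opens (Rn n)), ℝ)) : DL1 ω :=
  ⟨fun t => (φ t : ℂ), by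
    have h1 : ContDiff ℝ (⊤ : ℕ∞) fun t => (φ t : ℂ) := Complex.ofRealCLM.contDiff.comp φ.contDiff
    have h2 : HasCompactSupport fun t => (φ t : ℂ) :=
      φ.hasCompactSupport.comp_left Complex.ofReal_zero
    have := ω.isLocallyFiniteMeasure
    exact ⟨h1, fun j => (h1.continuous_iteratedFDeriv
      (mod_cast le_top)).integrable_of_hasCompactSupport (h2.iteratedFDeriv (𝕜 := ℝ) j)⟩⟩

end DL1

/-! ### The distribution spaces

Complex-valued distributions on `ℝⁿ` are the elements of Mathlib's `𝓓'(⊤, ℂ)`, that is, the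
continuous linear maps from real test functions to `ℂ` (equivalently, the continuous complex-linear
functionals on complex test functions). All spaces below are sets of such distributions: a dual
space of a space containing the test functions as a dense subspace is identified with
the set of distributions that are restrictions of its elements. -/

/-- `K₁'(ℝⁿ)`: the distributions that are restrictions of continuous functionals on `K₁(ℝⁿ)`. -/
def K1Dual (n : ℕ) : Set 𝓓'((⊤ : Opens (Rn n)), ℂ) :=
  {f | ∃ F : K1 n →L[ℂ] ℂ, ∀ φ : 𝓓((⊤ : Opens (Rn n)), ℝ), F (K1.ofTest φ) = f φ}

/-- `B'_ω(ℝⁿ)`: the distributions that are restrictions of continuous functionals on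
`D_{L¹_ω}(ℝⁿ)`. -/
def BDual {n : ℕ} (ω : Weight n) : Set 𝓓'((⊤ : Opens (Rn n)), ℂ) :=
  {f | ∃ F : DL1 ω →L[ℂ] ℂ, ∀ φ : 𝓓((⊤ : Opens (Rn n)), ℝ), F (DL1.ofTest ω φ) = f φ}

/-- The image of `D(ℝⁿ)` in the dual of `D_{L¹_ω}(ℝⁿ)`: the functionals
`χ ↦ ∫ φ(t) χ(t) dt` with a complex-valued test function `φ`. -/
def testFunctionals {n : ℕ} (ω : Weight n) : Set (DL1 ω →L[ℂ] ℂ) :=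
  {F | ∃ φ : 𝓓((⊤ : Opens (Rn n)), ℂ), ∀ χ : DL1 ω, F χ = ∫ t, φ t * χ t}

/-- `Ḃ'_ω(ℝⁿ)`: the closure of `D(ℝⁿ)` in `B'_ω(ℝⁿ)` for the strong dual topology, which is the
standard topology (of uniform convergence on bounded sets) of `DL1 ω →L[ℂ] ℂ`. -/
def BDotDual {n : ℕ} (ω : Weight n) : Set 𝓓'((⊤ : Opens (Rn n)), ℂ) :=
  {f | ∃ F ∈ closure (testFunctionals ω),
    ∀ φ : 𝓓((⊤ : Opens (Rn n)), ℝ), F (DL1.ofTest ω φ) = f φ}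

/-! ### Translations -/

/-- The translation `T_h φ(t) = φ(t - h)` of test functions, as a continuous linear map. -/
noncomputable def translateTest {n : ℕ} (h : Rn n) :
    𝓓((⊤ : Opens (Rn n)), ℝ) →L[ℝ] 𝓓((⊤ : Opens (Rn n)), ℝ) :=
  TestFunction.limitCLM ℝ
    (fun φ => ⟨fun t => φ (t - h), φ.contDiff.comp (contDiff_id.sub contDiff_const),
      φ.hasCompactSupport.comp_homeomorph (Homeomorph.subRight h), Set.subset_univ _⟩)
    (fun K _ =>
      let K' : Compacts (Rn n) := ⟨(fun t => t + h) '' K, K.isCompact.image (by fun_prop)⟩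
      TestFunction.ofSupportedInCLM ℝ (K := K') (Set.subset_univ _) ∘L
        ContDiffMapSupportedIn.mkCLM ℝ (fun φ t => φ (t - h)) (fun _ _ _ => rfl)
          (fun _ _ _ => rfl) (fun φ => φ.contDiff.comp (contDiff_id.sub contDiff_const))
          (fun φ t ht => φ.zero_on_compl fun hK => ht ⟨t - h, hK, sub_add_cancel t h⟩)
          (fun i _ => ⟨{i}, 1, zero_le_one, fun φ t _ => by
            rw [iteratedFDeriv_comp_sub, Finset.sup_singleton, one_mul]
            exact ContDiffMapSupportedIn.norm_iteratedFDeriv_apply_le_seminorm_top ℝ⟩))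
    (fun _ _ _ => rfl)

@[simp]
theorem translateTest_apply {n : ℕ} (h : Rn n) (φ : 𝓓((⊤ : Opens (Rn n)), ℝ)) (t : Rn n) :
    translateTest h φ t = φ (t - h) := rfl

/-- The translation `T_h f = f(· - h)` of distributions: `⟨T_h f, φ⟩ = ⟨f, T_{-h} φ⟩`. -/
noncomputable def translate {n : ℕ} (h : Rn n) :
    𝓓'((⊤ : Opens (Rn n)), ℂ) →L[ℝ] 𝓓'((⊤ : Opens (Rn n)), ℂ) :=
  (translateTest (-h)).precompCompactConvergenceCLM ℂ

theorem translate_apply {n : ℕ} (h : Rn n) (f : 𝓓'((⊤ : Opens (Rn n)), ℂ))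
    (φ : 𝓓((⊤ : Opens (Rn n)), ℝ)) : translate h f φ = f (translateTest (-h) φ) := rfl

end ExpType

/-! Everything follows from one cycle of implications: `f` lies in `K₁'`; its weighted translates
are bounded; `f` is dominated by finitely many suprema of `e^{k|t|} |D^j φ(t)|`; `f` lies in `Ḃ'_ω`
for some exponential `ω`; `f` lies in `B'_ω`; `f` lies in `K₁'`.

The ends are soft. Translation by `h` raises `ν_k` by a factor of at most `e^{k|h|}`, which gives
the bounded translates (`isVonNBounded_of_mem_K1Dual`). A moderate weight grows at most
exponentially, so `K₁` embeds continuously in `D_{L¹_ω}` (`exists_K1_inclusion`).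

From bounded translates to the estimate (`exists_norm_apply_le_of_isVonNBounded`): boundedness gives
a uniform estimate on all test functions supported in one compact set and all their translates. A
partition of unity by lattice translates cuts `φ` into such pieces, and a large enough `k` makes the
resulting series converge.

From the estimate to `Ḃ'_ω` (`mem_BDotDual_of_norm_apply_le`): the dual of `L¹` is `L^∞`, where test
functions are not dense, so the argument passes through `L²`. With `ω = exp((k+1)√(1+|t|²))`, a
Sobolev inequality for the weight with `k`, followed by Cauchy–Schwarz, dominates `f` by `L²` norms
of finitely many components of `ω D^j χ`. Hahn–Banach then writes `f` as a finite sum of functionals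
`G(ω D^j χ(v))` with `G` in the dual of `L²`. By Riesz and the density of test functions in `L²`,
`G` is approximated by integration against a test function, and integration by parts turns these
approximants into test functionals. -/

namespace ExpType

/-! ### Sobolev embedding by Fourier inversion, and Leibniz estimates. -/

section Sobolev

variable {V : Type*} [NormedAddCommGroup V] [InnerProductSpace ℝ V] [FiniteDimensional ℝ V]
  [MeasurableSpace V] [BorelSpace V]

open Module in
theorem integrable_exp_neg_norm : Integrable fun x : V => Real.exp (-‖x‖) := by
  have h := integrable_one_add_norm (E := V) (μ := volume) (r := (finrank ℝ V + 1 : ℕ))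
    (by exact_mod_cast Nat.lt_succ_self _)
  refine (h.const_mul (((finrank ℝ V + 1).factorial : ℝ) * Real.exp 1)).mono'
    (by fun_prop) (ae_of_all _ fun x => ?_)
  -- One term of the series of `e^{1+|x|}` already exceeds a multiple of `(1+|x|)^{d+1}`, whose
  -- inverse is integrable in dimension `d`.
  have h1 := Real.pow_div_factorial_le_exp (1 + ‖x‖) (by positivity) (finrank ℝ V + 1)
  rw [Real.norm_eq_abs, abs_of_pos (Real.exp_pos _), Real.rpow_neg (by positivity),
    Real.rpow_natCast, ← div_eq_mul_inv, le_div_iff₀ (by positivity)]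
  rw [div_le_iff₀ (by positivity), Real.exp_add] at h1
  calc _ ≤ Real.exp (-‖x‖) * (Real.exp 1 * Real.exp ‖x‖ * (finrank ℝ V + 1).factorial) := by
        gcongr
    _ = _ := by
        have : Real.exp (-‖x‖) * Real.exp ‖x‖ = 1 := by rw [← Real.exp_add]; simp
        linear_combination (Real.exp 1 * (finrank ℝ V + 1).factorial) * this

open Module FourierTransform in
/-- The Sobolev embedding of `W^{n+1,1}` in `L^∞`, for compactly supported smooth functions. -/
theorem exists_norm_le_sum_integral_iteratedFDeriv (V E : Type*) [NormedAddCommGroup V]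
    [InnerProductSpace ℝ V] [FiniteDimensional ℝ V] [MeasurableSpace V] [BorelSpace V]
    [NormedAddCommGroup E] [NormedSpace ℂ E] [CompleteSpace E] :
    ∃ C : ℝ, 0 ≤ C ∧ ∀ u : V → E, ContDiff ℝ (⊤ : ℕ∞) u → HasCompactSupport u → ∀ x, ‖u x‖ ≤
      C * ∑ j ∈ Finset.range (finrank ℝ V + 2), ∫ t, ‖iteratedFDeriv ℝ j u t‖ := by
  set d := finrank ℝ V + 1 with hd
  have hint := integrable_one_add_norm (E := V) (μ := volume) (r := (d : ℕ))
    (by exact_mod_cast Nat.lt_succ_self _)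
  set I := ∫ w : V, (1 + ‖w‖) ^ (-(d : ℝ)) with hI
  refine ⟨I * (2 ^ (d - 1) * (1 + 2 ^ d)), by positivity, fun u hu hs x => ?_⟩
  set S := ∑ j ∈ Finset.range (finrank ℝ V + 2), ∫ t, ‖iteratedFDeriv ℝ j u t‖ with hS
  have hi (j : ℕ) : Integrable (iteratedFDeriv ℝ j u) :=
    (hu.continuous_iteratedFDeriv (mod_cast le_top)).integrable_of_hasCompactSupport
      (hs.iteratedFDeriv (𝕜 := ℝ) j)
  -- Derivatives of `u` in `L¹` give decay of the Fourier transform. Only `k = 0` and `k = d` are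
  -- used below; `d` exceeds the dimension by one, so that the resulting decay is integrable.
  have key (k : ℕ) (hk : k ≤ d) (w : V) : ‖w‖ ^ k * ‖𝓕 u w‖ ≤ 2 ^ k * S := by
    have h := Real.pow_mul_norm_iteratedFDeriv_fourier_le (K := 0) (N := ⊤) hu
      (fun k n hk _ => by
        obtain rfl : k = 0 := by simpa using hk
        simpa using (hi n).norm) (k := 0) (n := k) le_rfl le_top w
    simp only [norm_iteratedFDeriv_zero] at h
    refine h.trans ?_
    simp only [pow_zero, one_mul, Nat.cast_zero, mul_zero, zero_add, Finset.range_one,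
      Finset.sum_product, Finset.sum_singleton]
    gcongr
    exact Finset.sum_le_sum_of_subset_of_nonneg (Finset.range_mono (by omega))
      fun _ _ _ => by positivity
  have hb (w : V) : ‖𝓕 u w‖ ≤ 2 ^ (d - 1) * (1 + 2 ^ d) * S * (1 + ‖w‖) ^ (-(d : ℝ)) := by
    rw [Real.rpow_neg (by positivity), Real.rpow_natCast, ← div_eq_mul_inv,
      le_div_iff₀ (by positivity)]
    have h0 := key 0 (by simp) w
    have h1 := key d le_rfl w
    have h2 := add_pow_le zero_le_one (norm_nonneg w) d
    rw [pow_zero, pow_zero, one_mul, one_mul] at h0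
    calc _ ≤ ‖𝓕 u w‖ * (2 ^ (d - 1) * (1 ^ d + ‖w‖ ^ d)) := by gcongr
      _ = 2 ^ (d - 1) * (‖𝓕 u w‖ + ‖w‖ ^ d * ‖𝓕 u w‖) := by ring
      _ ≤ 2 ^ (d - 1) * (S + 2 ^ d * S) := by gcongr
      _ = _ := by ring
  have hui : Integrable u := hu.continuous.integrable_of_hasCompactSupport hs
  have hF : Continuous (𝓕 u) := VectorFourier.fourierIntegral_continuous
      Real.continuous_fourierChar (by simpa using continuous_inner) hui
  have hFi : Integrable (𝓕 u) :=
    (hint.const_mul _).mono' hF.aestronglyMeasurable (ae_of_all _ hb)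
  have hx : 𝓕⁻ (𝓕 u) x = u x := hui.fourierInv_fourier_eq hFi hu.continuous.continuousAt
  rw [← hx, Real.fourierInv_eq]
  refine (norm_integral_le_integral_norm _).trans ?_
  simp only [Circle.norm_smul]
  refine (integral_mono hFi.norm (hint.const_mul _) hb).trans_eq ?_
  rw [integral_const_mul]
  ring

end Sobolev

/-- Currying is a linear isometry, so derivatives can be moved one at a time from the inner to the
outer operator without changing norms. This allows the Sobolev embedding to be applied to a
derivative. -/
theorem norm_iteratedFDeriv_iteratedFDeriv {𝕜 E F : Type*} [NontriviallyNormedField 𝕜]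
    [NormedAddCommGroup E] [NormedSpace 𝕜 E] [NormedAddCommGroup F] [NormedSpace 𝕜 F]
    (f : E → F) (i j : ℕ) (x : E) :
    ‖iteratedFDeriv 𝕜 i (iteratedFDeriv 𝕜 j f) x‖ = ‖iteratedFDeriv 𝕜 (i + j) f x‖ := by
  induction j generalizing i with
  | zero =>
    rw [iteratedFDeriv_zero_eq_comp, LinearIsometryEquiv.norm_iteratedFDeriv_comp_left]; rfl
  | succ j ih =>
    let e : (E →L[𝕜] (E [×j]→L[𝕜] F)) ≃ₗᵢ[𝕜] (E [×(j + 1)]→L[𝕜] F) :=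
      (continuousMultilinearCurryLeftEquiv 𝕜 (fun _ : Fin (j + 1) => E) F).symm
    have he : iteratedFDeriv 𝕜 (j + 1) f = e ∘ fderiv 𝕜 (iteratedFDeriv 𝕜 j f) :=
      iteratedFDeriv_succ_eq_comp_left
    have h := LinearIsometryEquiv.norm_iteratedFDeriv_comp_left (𝕜 := 𝕜) (E := E) (F := E →L[𝕜] (E [×j]→L[𝕜] F))
      (G := E [×(j + 1)]→L[𝕜] F) e (fderiv 𝕜 (iteratedFDeriv 𝕜 j f)) x i
    rw [he, h, norm_iteratedFDeriv_fderiv, ih, add_right_comm, add_assoc]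

/-- The Leibniz rule for the product with a function with bounded derivatives. -/
theorem exists_norm_iteratedFDeriv_mul_le {E : Type*} [NormedAddCommGroup E] [NormedSpace ℝ E]
    {A : Type*} [NormedRing A] [NormedAlgebra ℝ A] {χ : E → A}
    (hχ : ContDiff ℝ (⊤ : ℕ∞) χ) (hs : HasCompactSupport χ) (N : ℕ) :
    ∃ C : ℝ, 0 ≤ C ∧ ∀ (a : E) (φ : E → A), ContDiff ℝ (⊤ : ℕ∞) φ → ∀ j ≤ N, ∀ t,
      ‖iteratedFDeriv ℝ j (fun t => χ (t - a) * φ t) t‖ ≤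
        C * ∑ i ∈ Finset.range (N + 1), ‖iteratedFDeriv ℝ i φ t‖ := by
  have hb (i : ℕ) : ∃ B : ℝ, ∀ t, ‖iteratedFDeriv ℝ i χ t‖ ≤ B :=
    (hs.iteratedFDeriv (𝕜 := ℝ) i).exists_bound_of_continuous
      (hχ.continuous_iteratedFDeriv (mod_cast le_top))
  choose B hB using hb
  have hB0 (i : ℕ) : 0 ≤ B i := (norm_nonneg _).trans (hB i 0)
  set M := ∑ i ∈ Finset.range (N + 1), B i
  have hM : 0 ≤ M := Finset.sum_nonneg fun i _ => hB0 i
  refine ⟨2 ^ N * M, by positivity, fun a φ hφ j hj t => ?_⟩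
  set S := ∑ i ∈ Finset.range (N + 1), ‖iteratedFDeriv ℝ i φ t‖
  have h := norm_iteratedFDeriv_mul_le (n := j) (f := fun t => χ (t - a))
    (hχ.comp (contDiff_id.sub contDiff_const)) hφ t (mod_cast le_top)
  refine h.trans ?_
  calc _ ≤ ∑ i ∈ Finset.range (j + 1), (j.choose i : ℝ) * M * S := by
        refine Finset.sum_le_sum fun i hi => ?_
        have hi' : i ≤ j := by simpa [Nat.lt_succ_iff] using hi
        rw [iteratedFDeriv_comp_sub]
        gcongr
        · exact (hB i _).trans (Finset.single_le_sum (f := B) (fun i _ => hB0 i)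
            (by simp; omega))
        · exact Finset.single_le_sum (f := fun i => ‖iteratedFDeriv ℝ i φ t‖)
            (fun i _ => norm_nonneg _) (by simp; omega)
    _ = 2 ^ j * M * S := by
        rw [← Finset.sum_mul, ← Finset.sum_mul, ← Nat.cast_sum, Nat.sum_range_choose]; simp
    _ ≤ _ := by gcongr; norm_num

/-! ### Equicontinuity of the translates on a fixed compact set. -/

variable {n : ℕ}

/-- If the weighted translates of `f` are bounded in `𝓓'`, then they are equicontinuous on the
space of test functions supported in a given compact set. -/
theorem exists_norm_translateTest_le {f : 𝓓'((⊤ : Opens (Rn n)), ℂ)} {s : ℝ}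
    (hf : IsVonNBounded ℝ (Set.range fun h : Rn n => Real.exp (-s * ‖h‖) • translate (-h) f))
    (K : Compacts (Rn n)) :
    ∃ (N : ℕ) (C : ℝ), 0 ≤ C ∧ ∀ (h : Rn n) (φ : 𝓓_{K}(Rn n, ℝ)) (P : ℝ),
      (∀ j ≤ N, ∀ t, ‖iteratedFDeriv ℝ j φ t‖ ≤ P) →
      ‖f (translateTest h (TestFunction.ofSupportedIn (Set.subset_univ _) φ))‖
        ≤ C * Real.exp (s * ‖h‖) * P := by
  by_contra! H
  -- The negation is used with `N = m` and constant `(m+1)²`. One factor `m+1` will make the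
  -- normalised functions tend to zero, the other makes the functionals blow up on them.
  choose h φ P hP hlt using fun m : ℕ => H m (((m : ℝ) + 1) ^ 2) (by positivity)
  set ι : 𝓓_{K}(Rn n, ℝ) →L[ℝ] 𝓓((⊤ : Opens (Rn n)), ℝ) :=
    TestFunction.ofSupportedInCLM ℝ (Set.subset_univ _) with hι
  set v : ℕ → ℝ := fun m => Real.exp (-s * ‖h m‖) * ‖f (translateTest (h m) (ι (φ m)))‖ with hv
  have hP0 (m : ℕ) : 0 ≤ P m := (norm_nonneg _).trans (hP m 0 (Nat.zero_le _) 0)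
  have hvP (m : ℕ) : ((m : ℝ) + 1) ^ 2 * P m < v m := by
    have h1 : Real.exp (-s * ‖h m‖) * Real.exp (s * ‖h m‖) = 1 := by rw [← Real.exp_add]; simp
    calc ((m : ℝ) + 1) ^ 2 * P m
        = Real.exp (-s * ‖h m‖) * (((m : ℝ) + 1) ^ 2 * Real.exp (s * ‖h m‖) * P m) := by
          linear_combination (-((m : ℝ) + 1) ^ 2 * P m) * h1
      _ < v m := by
          rw [hv]
          exact mul_lt_mul_of_pos_left (hlt m) (Real.exp_pos _)
  have hv0 (m : ℕ) : 0 < v m := (mul_nonneg (by positivity) (hP0 m)).trans_lt (hvP m)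
  -- The normalisation makes the weighted functional take absolute value exactly `m+1` on `ψ m`,
  -- while every fixed seminorm of `ψ m` is eventually at most `1/(m+1)`.
  set ψ : ℕ → 𝓓_{K}(Rn n, ℝ) := fun m => (((m : ℝ) + 1) / v m) • φ m with hψ
  have hψ0 : Filter.Tendsto ψ Filter.atTop (nhds 0) := by
    rw [(ContDiffMapSupportedIn.withSeminorms ℝ (Rn n) ℝ ⊤ K).tendsto_nhds_atTop]
    intro i ε hε
    obtain ⟨m₀, hm₀⟩ := exists_nat_one_div_lt hε
    refine ⟨max i m₀, fun m hm => ?_⟩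
    rw [sub_zero, hψ, map_smul_eq_mul, Real.norm_eq_abs, abs_of_pos (by have := hv0 m; positivity)]
    have h1 : ContDiffMapSupportedIn.seminorm ℝ (Rn n) ℝ ⊤ K i (φ m) ≤ P m := by
      rw [ContDiffMapSupportedIn.seminorm_top_le_iff ℝ (hP0 m)]
      exact fun t _ => hP m i ((le_max_left _ _).trans hm) t
    calc ((m : ℝ) + 1) / v m * ContDiffMapSupportedIn.seminorm ℝ (Rn n) ℝ ⊤ K i (φ m)
        ≤ ((m : ℝ) + 1) / v m * P m := by have := hv0 m; gcongr
      _ ≤ 1 / ((m : ℝ) + 1) := by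
          rw [div_mul_eq_mul_div, div_le_div_iff₀ (hv0 m) (by positivity)]
          linarith [hvP m]
      _ ≤ 1 / ((m₀ : ℝ) + 1) := by
          gcongr; exact (le_max_right _ _).trans hm
      _ < ε := hm₀
  -- The topology of `𝓓'` is that of uniform convergence on compact sets, so boundedness may be
  -- tested on a null sequence together with its limit.
  have hcomp : IsCompact (insert (ι 0) (Set.range fun m => ι (ψ m))) :=
    ((ι.continuous.tendsto 0).comp hψ0).isCompact_insert_range
  have hb := UniformConvergenceCLM.isVonNBounded_iff.1 hf _ hcomp
  obtain ⟨R, hR⟩ := (NormedSpace.isVonNBounded_iff ℝ).1 hb |>.exists_norm_le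
  obtain ⟨m, hm⟩ := exists_nat_gt R
  have h2 := hR _ (Set.mem_image2_of_mem (Set.mem_range_self (h m))
    (Set.mem_insert_of_mem _ (Set.mem_range_self m)))
  have h3 : (Real.exp (-s * ‖h m‖) • translate (-h m) f) (ι (ψ m))
      = (((m : ℝ) + 1) / v m) •
        (Real.exp (-s * ‖h m‖) • f (translateTest (h m) (ι (φ m)))) := by
    rw [smul_comm]
    change Real.exp (-s * ‖h m‖) • (translate (-h m) f) (ι (ψ m)) = _
    rw [translate_apply, neg_neg, hψ]
    simp only [map_smul]
  simp only [h3] at h2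
  rw [norm_smul, norm_smul, Real.norm_eq_abs, abs_of_pos (by have := hv0 m; positivity),
    Real.norm_eq_abs, abs_of_pos (Real.exp_pos _)] at h2
  change ((m : ℝ) + 1) / v m * v m ≤ R at h2
  rw [div_mul_cancel₀ _ (hv0 m).ne'] at h2
  linarith

/-! ### A partition of unity by lattice translates -/

/-- A smooth function supported in `[-1, 1]ⁿ` whose translates by `ℤⁿ` sum to `1`. -/
noncomputable def cellFun (n : ℕ) (x : Rn n) : ℝ :=
  ∏ i, (Real.smoothTransition (x i + 1) - Real.smoothTransition (x i))

theorem contDiff_cellFun (n : ℕ) : ContDiff ℝ (⊤ : ℕ∞) (cellFun n) := by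
  refine contDiff_prod fun i _ => ?_
  have h : ContDiff ℝ (⊤ : ℕ∞) fun x : Rn n => x i := contDiff_piLp_apply (p := 2)
  exact (Real.smoothTransition.contDiff.comp (h.add contDiff_const)).sub
    (Real.smoothTransition.contDiff.comp h)

theorem support_cellFun (n : ℕ) : Function.support (cellFun n) ⊆ Metric.closedBall 0 n := by
  intro x hx
  have h1 (i : Fin n) : |x i| ≤ 1 := by
    by_contra! h
    refine hx (Finset.prod_eq_zero (Finset.mem_univ i) ?_)
    rcases lt_abs.1 h with h | h
    · rw [Real.smoothTransition.one_of_one_le (by linarith),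
        Real.smoothTransition.one_of_one_le (by linarith), sub_self]
    · rw [Real.smoothTransition.zero_of_nonpos (by linarith),
        Real.smoothTransition.zero_of_nonpos (by linarith), sub_self]
  rw [mem_closedBall_zero_iff, EuclideanSpace.norm_eq, Real.sqrt_le_left (by positivity)]
  calc ∑ i, ‖x i‖ ^ 2 ≤ ∑ _i : Fin n, (1 : ℝ) := by
        gcongr with i
        exact pow_le_one₀ (norm_nonneg _) (h1 i)
    _ = n := by simp
    _ ≤ (n : ℝ) ^ 2 := by exact_mod_cast Nat.le_self_pow two_ne_zero n

theorem hasCompactSupport_cellFun (n : ℕ) : HasCompactSupport (cellFun n) :=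
  HasCompactSupport.of_support_subset_isCompact (isCompact_closedBall 0 _) (support_cellFun n)

/-- The point of `ℤⁿ` with the given coordinates. -/
noncomputable def latticePt (m : Fin n → ℤ) : Rn n := WithLp.toLp 2 fun i => (m i : ℝ)

/-- The integers in `[-M, M)`. -/
def intBox (M : ℕ) : Finset ℤ :=
  (Finset.range (2 * M)).map ⟨fun k : ℕ => (k : ℤ) - M, fun a b h => by simpa using h⟩

/-- In each coordinate the sum telescopes, and the product of these sums expands into the sum over
the box. The half-open box needs size `M + 1` for the upper end of the telescope to vanish. -/
theorem sum_cellFun_eq_one {M : ℕ} {x : Rn n} (hx : ‖x‖ ≤ M) :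
    ∑ m ∈ Fintype.piFinset fun _ : Fin n => intBox (M + 1), cellFun n (x - latticePt m) = 1 := by
  set g : Fin n → ℤ → ℝ := fun i k =>
    Real.smoothTransition (x i - k + 1) - Real.smoothTransition (x i - k)
  have h : ∀ i, ∑ k ∈ intBox (M + 1), g i k = 1 := by
    intro i
    have hi : |x i| ≤ M := (PiLp.norm_apply_le x i).trans hx
    have := Finset.sum_range_sub' (fun k : ℕ => Real.smoothTransition (x i + (M + 1) + 1 - k))
      (2 * (M + 1))
    rw [Real.smoothTransition.one_of_one_le (by push_cast; linarith [neg_le_of_abs_le hi]),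
      Real.smoothTransition.zero_of_nonpos (by push_cast; linarith [le_of_abs_le hi]),
      sub_zero] at this
    rw [← this, intBox, Finset.sum_map]
    refine Finset.sum_congr rfl fun k _ => ?_
    change Real.smoothTransition (x i - (((k : ℤ) - (M + 1 : ℕ) : ℤ) : ℝ) + 1) -
      Real.smoothTransition (x i - (((k : ℤ) - (M + 1 : ℕ) : ℤ) : ℝ)) = _
    push_cast
    congr! 2 <;> ring
  calc _ = ∑ m ∈ Fintype.piFinset fun _ : Fin n => intBox (M + 1), ∏ i, g i (m i) := by
        simp only [cellFun, latticePt, g]; rfl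
    _ = ∏ i, ∑ k ∈ intBox (M + 1), g i k := (Finset.prod_univ_sum _ _).symm
    _ = 1 := by simp [h]

/-- Since `n |m|` is at least the sum of the `|m i|`, the sum is dominated by the `n`-th power of a
one-dimensional geometric series. -/
theorem exists_sum_exp_neg_norm_latticePt_le (n : ℕ) : ∃ C : ℝ, 0 ≤ C ∧ ∀ M : ℕ,
    ∑ m ∈ Fintype.piFinset fun _ : Fin n => intBox M, Real.exp (-n * ‖latticePt m‖) ≤ C := by
  have hs : Summable fun k : ℤ => Real.exp (-|(k : ℝ)|) := by
    refine Summable.of_nat_of_neg ?_ ?_ <;> simpa using Real.summable_exp_neg_nat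
  refine ⟨(∑' k : ℤ, Real.exp (-|(k : ℝ)|)) ^ n,
    pow_nonneg (tsum_nonneg fun _ => (Real.exp_pos _).le) _, fun M => ?_⟩
  calc _ ≤ ∑ m ∈ Fintype.piFinset fun _ : Fin n => intBox M, ∏ i, Real.exp (-|(m i : ℝ)|) := by
        refine Finset.sum_le_sum fun m _ => ?_
        rw [← Real.exp_sum, Real.exp_le_exp, Finset.sum_neg_distrib, neg_mul, neg_le_neg_iff]
        calc ∑ i, |(m i : ℝ)| ≤ ∑ _i : Fin n, ‖latticePt m‖ :=
              Finset.sum_le_sum fun i _ => PiLp.norm_apply_le (latticePt m) i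
          _ = n * ‖latticePt m‖ := by simp
    _ = ∏ _i : Fin n, ∑ k ∈ intBox M, Real.exp (-|(k : ℝ)|) :=
        (Finset.prod_univ_sum _ fun _ (k : ℤ) => Real.exp (-|(k : ℝ)|)).symm
    _ = (∑ k ∈ intBox M, Real.exp (-|(k : ℝ)|)) ^ n := by simp
    _ ≤ _ := by
        gcongr
        exact hs.sum_le_tsum _ fun _ _ => (Real.exp_pos _).le

/-- If the weighted translates of `f` are bounded in `𝓓'`, then `f` is continuous for one of the
norms of `K₁`. -/
theorem exists_norm_apply_le_of_isVonNBounded {f : 𝓓'((⊤ : Opens (Rn n)), ℂ)} {s : ℝ}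
    (hf : IsVonNBounded ℝ (Set.range fun h : Rn n => Real.exp (-s * ‖h‖) • translate (-h) f)) :
    ∃ (N k : ℕ) (C : ℝ), 0 ≤ C ∧ ∀ (φ : 𝓓((⊤ : Opens (Rn n)), ℝ)) (P : ℝ),
      (∀ j ≤ N, ∀ t, Real.exp (k * ‖t‖) * ‖iteratedFDeriv ℝ j φ t‖ ≤ P) → ‖f φ‖ ≤ C * P := by
  let K : Compacts (Rn n) := ⟨Metric.closedBall 0 n, isCompact_closedBall 0 _⟩
  obtain ⟨N, C₁, hC₁, H₁⟩ := exists_norm_translateTest_le hf K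
  obtain ⟨C₂, hC₂, H₂⟩ := exists_norm_iteratedFDeriv_mul_le (contDiff_cellFun n)
    (hasCompactSupport_cellFun n) N
  obtain ⟨C₃, hC₃, H₃⟩ := exists_sum_exp_neg_norm_latticePt_le n
  -- The translate by `m` costs `e^{s|m|}` and the decay of `φ` gains `e^{-k|m|}`; this choice
  -- leaves the summable factor `e^{-n|m|}`.
  obtain ⟨k, hk⟩ := exists_nat_ge (s + n)
  -- `N + 1` counts the derivatives in the Leibniz sum, and `e^{kn}` is the loss in replacing `t +
  -- m` by `m` for `t` in the ball of radius `n`.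
  set D := C₁ * (C₂ * ((N + 1) * Real.exp (k * n))) with hD
  refine ⟨N, k, D * C₃, by positivity, fun φ P hP => ?_⟩
  have hP0 : 0 ≤ P := le_trans (by positivity) (hP 0 (Nat.zero_le _) 0)
  -- The pieces of `φ` are moved back to the origin, so that all are supported in the same compact
  -- set `K`.
  let φm (m : Fin n → ℤ) : 𝓓_{K}(Rn n, ℝ) := ContDiffMapSupportedIn.of_support_subset
    (f := fun t => cellFun n t * φ (t + latticePt m))
    ((contDiff_cellFun n).mul (φ.contDiff.comp (contDiff_id.add contDiff_const)))
    ((Function.support_mul_subset_left _ _).trans (support_cellFun n))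
  have hφm (m : Fin n → ℤ) : ∀ j ≤ N, ∀ t, ‖iteratedFDeriv ℝ j (φm m) t‖ ≤
      C₂ * ((N + 1) * Real.exp (k * n)) * Real.exp (-k * ‖latticePt m‖) * P := by
    intro j hj t
    by_cases ht : t ∈ K
    · have h := H₂ 0 (fun t => φ (t + latticePt m))
        (φ.contDiff.comp (contDiff_id.add contDiff_const)) j hj t
      simp only [sub_zero, iteratedFDeriv_comp_add_right] at h
      refine h.trans ?_
      have hi : ∀ i ∈ Finset.range (N + 1), ‖iteratedFDeriv ℝ i φ (t + latticePt m)‖ ≤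
          Real.exp (k * n) * Real.exp (-k * ‖latticePt m‖) * P := by
        intro i hi
        have h1 := hP i (by simpa [Nat.lt_succ_iff] using hi) (t + latticePt m)
        have ht' : ‖t‖ ≤ n := mem_closedBall_zero_iff.1 ht
        have h2 : ‖latticePt m‖ ≤ ‖t + latticePt m‖ + ‖t‖ := by
          simpa using norm_sub_le (t + latticePt m) t
        calc _ = Real.exp (-(k * ‖t + latticePt m‖)) * (Real.exp (k * ‖t + latticePt m‖) *
              ‖iteratedFDeriv ℝ i φ (t + latticePt m)‖) := by
              rw [← mul_assoc, ← Real.exp_add]; simp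
          _ ≤ Real.exp (k * n + -k * ‖latticePt m‖) * P := by
              gcongr
              have : (k : ℝ) * ‖latticePt m‖ ≤ k * (‖t + latticePt m‖ + n) := by gcongr; linarith
              linarith
          _ = _ := by rw [Real.exp_add]
      calc _ ≤ C₂ * ∑ _i ∈ Finset.range (N + 1),
            Real.exp (k * n) * Real.exp (-k * ‖latticePt m‖) * P := by
            gcongr with i hi'; exact hi i hi'
        _ = _ := by simp; ring
    · rw [(φm m).iteratedFDeriv_zero_on_compl ht]
      simp only [Pi.zero_apply, norm_zero]
      positivity
  obtain ⟨M, hM⟩ : ∃ M : ℕ, ∀ x, φ x ≠ 0 → ‖x‖ ≤ M := by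
    obtain ⟨R, hR⟩ := φ.hasCompactSupport.isBounded.exists_norm_le
    obtain ⟨M, hM⟩ := exists_nat_ge R
    exact ⟨M, fun x hx => (hR x (subset_tsupport _ hx)).trans hM⟩
  have hsum : φ = ∑ m ∈ Fintype.piFinset fun _ : Fin n => intBox (M + 1),
      translateTest (latticePt m) (TestFunction.ofSupportedIn (Set.subset_univ _) (φm m)) := by
    ext x
    have : ∀ m : Fin n → ℤ, translateTest (latticePt m)
        (TestFunction.ofSupportedIn (Ω := ⊤) (Set.subset_univ _) (φm m)) x
          = cellFun n (x - latticePt m) * φ x := by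
      intro m
      rw [translateTest_apply]
      change cellFun n (x - latticePt m) * φ (x - latticePt m + latticePt m) = _
      rw [sub_add_cancel]
    let ev : 𝓓((⊤ : Opens (Rn n)), ℝ) →+ ℝ :=
      { toFun := fun ψ => ψ x, map_zero' := rfl, map_add' := fun _ _ => rfl }
    refine Eq.trans ?_ (map_sum ev _ _).symm
    change φ x = ∑ m ∈ _, translateTest (latticePt m)
      (TestFunction.ofSupportedIn (Ω := ⊤) (Set.subset_univ _) (φm m)) x
    simp only [this]
    rw [← Finset.sum_mul]
    by_cases hx : φ x = 0
    · rw [hx, mul_zero]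
    · rw [sum_cellFun_eq_one (hM x hx), one_mul]
  rw [hsum, map_sum]
  calc _ ≤ ∑ m ∈ Fintype.piFinset fun _ : Fin n => intBox (M + 1),
        D * P * Real.exp (-n * ‖latticePt m‖) := by
        refine (norm_sum_le _ _).trans (Finset.sum_le_sum fun m _ => ?_)
        refine (H₁ _ _ _ (hφm m)).trans ?_
        calc _ = D * P * Real.exp (s * ‖latticePt m‖ + -k * ‖latticePt m‖) := by
              rw [Real.exp_add]; ring
          _ ≤ _ := by
              gcongr
              nlinarith [norm_nonneg (latticePt m)]
    _ ≤ D * P * C₃ := by rw [← Finset.mul_sum]; gcongr; exact H₃ _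
    _ = _ := by ring

/-! ### The inclusion of `K₁` in `D_{L¹_ω}` -/

namespace K1

theorem exp_mul_norm_le_nu {k j : ℕ} (hj : j ≤ k) (φ : K1 n) (t : Rn n) :
    Real.exp (k * ‖t‖) * ‖iteratedFDeriv ℝ j φ t‖ ≤ nu n k φ := by
  have h1 : Real.exp (k * ‖t‖) * ‖iteratedFDeriv ℝ j φ t‖ ≤ weightedSup n k j φ := by
    obtain ⟨C, hC⟩ := φ.2.2 k j
    exact le_ciSup (f := fun t : Rn n => Real.exp (k * ‖t‖) * ‖iteratedFDeriv ℝ j φ t‖)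
      ⟨C, by rintro _ ⟨t, rfl⟩; exact hC t⟩ t
  exact h1.trans (Seminorm.le_finset_sup_apply (p := fun j => weightedSup n k j)
    (Finset.mem_range.2 (Nat.lt_succ_of_le hj)))

theorem nu_le {k : ℕ} {φ : K1 n} {R : ℝ} (hR : 0 ≤ R)
    (h : ∀ j ≤ k, ∀ t, Real.exp (k * ‖t‖) * ‖iteratedFDeriv ℝ j φ t‖ ≤ R) : nu n k φ ≤ R :=
  Seminorm.finset_sup_apply_le hR fun j hj =>
    Real.iSup_le (h j (Nat.lt_succ_iff.1 (Finset.mem_range.1 hj))) hR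

theorem nu_mono (n : ℕ) : Monotone (nu n) := by
  intro k l hkl φ
  refine nu_le (apply_nonneg _ _) fun j hj t => le_trans ?_ (exp_mul_norm_le_nu (hj.trans hkl) φ t)
  gcongr

/-- A continuous functional on `K₁` is continuous for one of the norms `ν_k`. -/
theorem exists_norm_le_nu (F : K1 n →L[ℂ] ℂ) :
    ∃ (k : ℕ) (C : ℝ), 0 ≤ C ∧ ∀ φ, ‖F φ‖ ≤ C * nu n k φ := by
  obtain ⟨s, C, -, h⟩ := Seminorm.bound_of_continuous (withSeminorms n)
    ((normSeminorm ℂ ℂ).comp F.toLinearMap) (continuous_norm.comp F.continuous)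
  refine ⟨s.sup id, C, C.2, fun φ => (h φ).trans ?_⟩
  change (C : ℝ) * s.sup (nu n) φ ≤ _
  gcongr
  exact (Finset.sup_le fun i hi => nu_mono n (Finset.le_sup (f := id) hi) :
    s.sup (nu n) ≤ nu n (s.sup id)) φ

end K1

theorem Weight.integrable_iff (ω : Weight n) {F : Type*} [NormedAddCommGroup F] [NormedSpace ℝ F]
    {g : Rn n → F} : Integrable g ω.measure ↔ Integrable fun t => ω t • g t := by
  rw [Weight.measure, integrable_withDensity_iff_integrable_smul' (by
    exact ω.measurable'.ennreal_ofReal) (by simp)]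
  simp only [ENNReal.toReal_ofReal (ω.pos' _).le]

theorem Weight.integral_eq (ω : Weight n) {F : Type*} [NormedAddCommGroup F] [NormedSpace ℝ F]
    (g : Rn n → F) : ∫ t, g t ∂ω.measure = ∫ t, ω t • g t := by
  rw [Weight.measure, integral_withDensity_eq_integral_toReal_smul (by
    exact ω.measurable'.ennreal_ofReal) (by simp)]
  simp only [ENNReal.toReal_ofReal (ω.pos' _).le]

/-- Moderateness with `y = 0` bounds `ω` by a multiple of `e^{a|t|}`; any `k ≥ a + 1` then leaves
`e^{-|t|}`. -/
theorem Weight.exists_integrable_exp (ω : Weight n) :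
    ∃ k : ℕ, Integrable (fun t => Real.exp (-k * ‖t‖)) ω.measure := by
  obtain ⟨A, a, hA, ha, h⟩ := ω.moderate'
  obtain ⟨k, hk⟩ := exists_nat_ge (a + 1)
  refine ⟨k, ω.integrable_iff.2 ?_⟩
  have h0 := ω.pos' 0
  refine ((integrable_exp_neg_norm (V := Rn n)).const_mul (A * ω 0)).mono'
    (ω.measurable'.mul (by fun_prop)).aestronglyMeasurable (ae_of_all _ fun t => ?_)
  have hω := ω.pos' t
  have h1 := h t 0
  rw [add_zero] at h1
  rw [norm_smul, Real.norm_eq_abs, Real.norm_eq_abs, abs_of_pos hω, abs_of_pos (Real.exp_pos _)]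
  calc ω t * Real.exp (-k * ‖t‖)
      ≤ A * ω 0 * Real.exp (a * ‖t‖) * Real.exp (-k * ‖t‖) := by gcongr
    _ = A * ω 0 * Real.exp (a * ‖t‖ + -k * ‖t‖) := by rw [mul_assoc, ← Real.exp_add]
    _ ≤ A * ω 0 * Real.exp (-‖t‖) := by
        gcongr
        nlinarith [norm_nonneg t]

/-- The continuous inclusion of `K₁` in `D_{L¹_ω}`. -/
theorem exists_K1_inclusion (ω : Weight n) :
    ∃ ι : K1 n →L[ℂ] DL1 ω, ∀ φ, ((ι φ : DL1 ω) : Rn n → ℂ) = φ := by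
  obtain ⟨k, hk⟩ := ω.exists_integrable_exp
  have hbound (φ : K1 n) (l : ℕ) (hl : k ≤ l) (j : ℕ) (hj : j ≤ l) (t : Rn n) :
      ‖iteratedFDeriv ℝ j φ t‖ ≤ K1.nu n l φ * Real.exp (-k * ‖t‖) := by
    have h := K1.exp_mul_norm_le_nu hj φ t
    calc _ = Real.exp (l * ‖t‖) * ‖iteratedFDeriv ℝ j φ t‖ * Real.exp (-l * ‖t‖) := by
          rw [mul_right_comm, ← Real.exp_add]; simp
      _ ≤ _ := by gcongr
  have hint (φ : K1 n) (j : ℕ) : Integrable (iteratedFDeriv ℝ j φ) ω.measure :=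
    (hk.const_mul (K1.nu n (max k j) φ)).mono'
      (φ.2.1.continuous_iteratedFDeriv (mod_cast le_top)).aestronglyMeasurable
      (ae_of_all _ fun t => hbound φ _ (le_max_left _ _) j (le_max_right _ _) t)
  let L : K1 n →ₗ[ℂ] DL1 ω :=
    { toFun := fun φ => ⟨φ.1, φ.2.1, hint φ⟩
      map_add' := fun _ _ => rfl
      map_smul' := fun _ _ => rfl }
  refine ⟨⟨L, WithSeminorms.continuous_of_isBounded (K1.withSeminorms n) (DL1.withSeminorms ω) L
    fun i => ?_⟩, fun φ => rfl⟩
  -- The index must provide both the exponential decay needed for integrability (`k`) and the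
  -- derivatives up to order `i`.
  refine ⟨{max k i}, ⟨∫ t, Real.exp (-k * ‖t‖) ∂ω.measure, by positivity⟩, fun φ => ?_⟩
  rw [Finset.sup_singleton]
  refine Seminorm.finset_sup_apply_le (by positivity) fun j hj => ?_
  have hj' : j ≤ max k i := (Nat.lt_succ_iff.1 (Finset.mem_range.1 hj)).trans (le_max_right _ _)
  refine (integral_mono (hint φ j).norm (hk.const_mul _)
    (hbound φ _ (le_max_left _ _) j hj')).trans_eq ?_
  rw [integral_const_mul, mul_comm]
  rfl

theorem BDual_subset_K1Dual (ω : Weight n) : BDual ω ⊆ K1Dual n := by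
  rintro f ⟨F, hF⟩
  obtain ⟨ι, hι⟩ := exists_K1_inclusion ω
  refine ⟨F.comp ι, fun φ => ?_⟩
  rw [← hF φ]
  exact congrArg F (Subtype.ext (hι _))

theorem BDotDual_subset_BDual (ω : Weight n) : BDotDual ω ⊆ BDual ω := by
  rintro f ⟨F, -, hF⟩
  exact ⟨F, hF⟩

/-! ### Bounded translates of the elements of `K₁'` -/

theorem norm_iteratedFDeriv_ofReal {E : Type*} [NormedAddCommGroup E] [NormedSpace ℝ E] {φ : E → ℝ}
    (hφ : ContDiff ℝ (⊤ : ℕ∞) φ) (j : ℕ) (t : E) :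
    ‖iteratedFDeriv ℝ j (fun t => (φ t : ℂ)) t‖ = ‖iteratedFDeriv ℝ j φ t‖ :=
  Complex.ofRealLI.norm_iteratedFDeriv_comp_left hφ.contDiffAt (i := j) (mod_cast le_top)

theorem nu_ofTest_translateTest_le (k : ℕ) (h : Rn n) (φ : 𝓓((⊤ : Opens (Rn n)), ℝ)) :
    K1.nu n k (K1.ofTest (translateTest h φ)) ≤ Real.exp (k * ‖h‖) * K1.nu n k (K1.ofTest φ) := by
  refine K1.nu_le (by positivity) fun j hj t => ?_
  have h1 := K1.exp_mul_norm_le_nu hj (K1.ofTest φ) (t - h)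
  have h2 : iteratedFDeriv ℝ j (K1.ofTest (translateTest h φ)) t
      = iteratedFDeriv ℝ j (K1.ofTest φ) (t - h) :=
    iteratedFDeriv_comp_sub (f := fun t => (φ t : ℂ)) j h t
  rw [h2]
  calc _ ≤ Real.exp (k * ‖h‖ + k * ‖t - h‖) * ‖iteratedFDeriv ℝ j (K1.ofTest φ) (t - h)‖ := by
        gcongr
        rw [← mul_add]
        gcongr
        simpa using norm_add_le h (t - h)
    _ ≤ _ := by rw [Real.exp_add, mul_assoc]; gcongr

/-- Continuity on the inductive limit is checked on each `𝓓_K`, where the exponential factor is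
bounded. It serves to bound `ν_k` on compact sets of test functions. -/
theorem continuous_nu_ofTest (k : ℕ) :
    Continuous fun φ : 𝓓((⊤ : Opens (Rn n)), ℝ) => K1.nu n k (K1.ofTest φ) := by
  have := (K1.withSeminorms n).topologicalAddGroup
  have := (K1.withSeminorms n).continuousSMul
  have := (K1.withSeminorms n).toLocallyConvexSpace
  have : ContinuousSMul ℝ (K1 n) := IsScalarTower.continuousSMul ℂ
  let L : 𝓓((⊤ : Opens (Rn n)), ℝ) →ₗ[ℝ] K1 n :=
    { toFun := K1.ofTest
      map_add' := fun φ ψ => Subtype.ext (funext fun t => Complex.ofReal_add _ _)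
      map_smul' := fun c φ => Subtype.ext (funext fun t => Complex.ofReal_mul _ _) }
  have hL : Continuous L := by
    rw [TestFunction.continuous_iff_continuous_comp]
    intro K hK
    rw [continuous_iff_continuousAt]
    intro φ
    refine ((K1.withSeminorms n).tendsto_nhds _ _).2 fun i ε hε => ?_
    obtain ⟨R, hR⟩ := K.isCompact.isBounded.exists_norm_le
    have hle (ψ : 𝓓_{K}(Rn n, ℝ)) : K1.nu n i (L (TestFunction.ofSupportedIn hK ψ)) ≤
        Real.exp (i * R) * ∑ j ∈ Finset.range (i + 1),
          ContDiffMapSupportedIn.seminorm ℝ (Rn n) ℝ ⊤ K j ψ := by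
      have h0 : ∀ j ∈ Finset.range (i + 1),
          0 ≤ ContDiffMapSupportedIn.seminorm ℝ (Rn n) ℝ ⊤ K j ψ :=
        fun j _ => apply_nonneg _ _
      refine K1.nu_le (mul_nonneg (Real.exp_pos _).le (Finset.sum_nonneg h0)) fun j hj t => ?_
      have h1 : ‖iteratedFDeriv ℝ j (L (TestFunction.ofSupportedIn hK ψ) : K1 n) t‖
          = ‖iteratedFDeriv ℝ j ψ t‖ := norm_iteratedFDeriv_ofReal ψ.contDiff j t
      rw [h1]
      by_cases ht : t ∈ K
      · gcongr
        · exact hR t ht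
        · exact (ContDiffMapSupportedIn.norm_iteratedFDeriv_apply_le_seminorm_top ℝ).trans
            (Finset.single_le_sum h0 (Finset.mem_range.2 (Nat.lt_succ_of_le hj)))
      · rw [ψ.iteratedFDeriv_zero_on_compl ht]
        simpa using mul_nonneg (Real.exp_pos _).le (Finset.sum_nonneg h0)
    have hcont : Continuous fun ψ : 𝓓_{K}(Rn n, ℝ) => Real.exp (i * R) *
        ∑ j ∈ Finset.range (i + 1), ContDiffMapSupportedIn.seminorm ℝ (Rn n) ℝ ⊤ K j (ψ - φ) := by
      refine continuous_const.mul (continuous_finsetSum _ fun j _ => ?_)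
      exact ((ContDiffMapSupportedIn.withSeminorms ℝ (Rn n) ℝ ⊤ K).continuous_seminorm j).comp
        (continuous_id.sub continuous_const)
    have h0 := (hcont.tendsto φ).eventually_lt_const (u := ε) (by simpa using hε)
    filter_upwards [h0] with ψ hψ
    refine lt_of_le_of_lt ?_ hψ
    have : (L ∘ TestFunction.ofSupportedIn hK) ψ - (L ∘ TestFunction.ofSupportedIn hK) φ
        = L (TestFunction.ofSupportedIn hK (ψ - φ)) := (map_sub L _ _).symm
    rw [this]
    exact hle _
  exact ((K1.withSeminorms n).continuous_seminorm k).comp hL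

/-- With `s = k`, the weight cancels exactly the factor `e^{k|h|}` by which a translation can raise
`ν_k`. -/
theorem isVonNBounded_of_mem_K1Dual {f : 𝓓'((⊤ : Opens (Rn n)), ℂ)} (hf : f ∈ K1Dual n) :
    ∃ s : ℝ, IsVonNBounded ℝ
      (Set.range fun h : Rn n => Real.exp (-s * ‖h‖) • translate (-h) f) := by
  obtain ⟨F, hF⟩ := hf
  obtain ⟨k, C, hC, h⟩ := K1.exists_norm_le_nu F
  refine ⟨k, UniformConvergenceCLM.isVonNBounded_iff.2 fun S hS => ?_⟩
  obtain ⟨R, hR⟩ := (hS.image (continuous_nu_ofTest k)).bddAbove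
  rw [NormedSpace.isVonNBounded_iff]
  refine isBounded_iff_forall_norm_le.2 ⟨C * R, ?_⟩
  rintro _ ⟨_, ⟨h', rfl⟩, φ, hφ, rfl⟩
  change ‖Real.exp (-k * ‖h'‖) • translate (-h') f φ‖ ≤ _
  rw [translate_apply, neg_neg, ← hF, norm_smul, Real.norm_eq_abs, abs_of_pos (Real.exp_pos _)]
  calc _ ≤ Real.exp (-k * ‖h'‖) * (C * (Real.exp (k * ‖h'‖) * K1.nu n k (K1.ofTest φ))) := by
        gcongr
        refine (h _).trans ?_
        gcongr
        exact nu_ofTest_translateTest_le k h' φ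
    _ = Real.exp (-k * ‖h'‖) * Real.exp (k * ‖h'‖) * (C * K1.nu n k (K1.ofTest φ)) := by ring
    _ = C * K1.nu n k (K1.ofTest φ) := by rw [← Real.exp_add]; simp
    _ ≤ C * R := by
        gcongr
        exact hR (Set.mem_image_of_mem _ hφ)

/-! ### Sobolev inequality in `D_{L¹_ω}` and the maps to `L²`. -/

namespace DL1

variable {ω : Weight n}

theorem weightedInt_le_norms {k j : ℕ} (hj : j ≤ k) (χ : DL1 ω) :
    weightedInt ω j χ ≤ norms ω k χ :=
  Seminorm.le_finset_sup_apply (p := fun j => weightedInt ω j)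
    (Finset.mem_range.2 (Nat.lt_succ_of_le hj))

theorem norms_mono (ω : Weight n) : Monotone (norms ω) := fun _ _ hkl =>
  Finset.sup_mono (Finset.range_mono (Nat.succ_le_succ hkl))

theorem norms_le_sum (k : ℕ) (χ : DL1 ω) :
    norms ω k χ ≤ ∑ j ∈ Finset.range (k + 1), weightedInt ω j χ :=
  Seminorm.finset_sup_apply_le (Finset.sum_nonneg fun _ _ => apply_nonneg _ _) fun _ hj =>
    Finset.single_le_sum (f := fun j => weightedInt ω j χ) (fun _ _ => apply_nonneg _ _) hj

theorem weightedInt_apply (j : ℕ) (χ : DL1 ω) :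
    weightedInt ω j χ = ∫ t, ω t * ‖iteratedFDeriv ℝ j χ t‖ :=
  ω.integral_eq fun t => ‖iteratedFDeriv ℝ j χ t‖

theorem integrable_weight_mul (j : ℕ) (χ : DL1 ω) :
    Integrable fun t => ω t * ‖iteratedFDeriv ℝ j χ t‖ :=
  ω.integrable_iff.1 (χ.2.2 j).norm

/-- A Sobolev inequality in `D_{L¹_ω}`: the derivatives are bounded by a multiple of `1/ω`. -/
theorem exists_weight_mul_norm_le (ω : Weight n) (j : ℕ) :
    ∃ C : ℝ, 0 ≤ C ∧ ∀ (χ : DL1 ω) (t : Rn n),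
      ω t * ‖iteratedFDeriv ℝ j χ t‖ ≤ C * norms ω (j + n + 1) χ := by
  obtain ⟨A, a, hA, ha, hω⟩ := ω.moderate'
  -- The cutoff is `1` near the centre, hence leaves the derivatives at `t` unchanged, and vanishes
  -- beyond distance `2`, where moderateness costs at most `A e^{2a}`.
  let b : ContDiffBump (0 : Rn n) := ⟨1, 2, one_pos, one_lt_two⟩
  have hθ : ContDiff ℝ (⊤ : ℕ∞) fun x => (b x : ℂ) := Complex.ofRealCLM.contDiff.comp b.contDiff
  have hθs : HasCompactSupport fun x => (b x : ℂ) :=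
    b.hasCompactSupport.comp_left Complex.ofReal_zero
  obtain ⟨C₁, hC₁, H₁⟩ := exists_norm_le_sum_integral_iteratedFDeriv (Rn n) (Rn n [×j]→L[ℝ] ℂ)
  obtain ⟨C₂, hC₂, H₂⟩ := exists_norm_iteratedFDeriv_mul_le hθ hθs (j + n + 1)
  refine ⟨C₁ * ((n + 2) * (A * Real.exp (a * 2) * C₂ * (j + n + 2))), by positivity,
    fun χ t => ?_⟩
  set u : Rn n → ℂ := fun x => b (x - t) * χ x with hu
  have hus : ContDiff ℝ (⊤ : ℕ∞) u := (hθ.comp (contDiff_id.sub contDiff_const)).mul χ.2.1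
  have huc : HasCompactSupport u :=
    (hθs.comp_homeomorph (Homeomorph.subRight t)).mul_right
  have hut : iteratedFDeriv ℝ j u t = iteratedFDeriv ℝ j χ t := by
    refine Filter.EventuallyEq.eq_of_nhds (Filter.EventuallyEq.iteratedFDeriv (𝕜 := ℝ) ?_ j)
    filter_upwards [Metric.ball_mem_nhds t one_pos] with x hx
    rw [hu]
    simp only
    rw [b.one_of_mem_closedBall (by simpa [dist_eq_norm] using (mem_ball_iff_norm.1 hx).le)]
    simp
  have hus' : ContDiff ℝ (⊤ : ℕ∞) (iteratedFDeriv ℝ j u) :=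
    hus.iteratedFDeriv_right (m := (⊤ : ℕ∞)) (i := j) (mod_cast le_top)
  -- The embedding costs `n + 1` derivatives beyond the `j` already taken, whence the index `j + n +
  -- 1`.
  have h := H₁ (iteratedFDeriv ℝ j u) hus' (huc.iteratedFDeriv (𝕜 := ℝ) j) t
  simp only [norm_iteratedFDeriv_iteratedFDeriv, finrank_euclideanSpace_fin] at h
  rw [hut] at h
  have hi : ∀ i ∈ Finset.range (n + 2), ω t * ∫ x, ‖iteratedFDeriv ℝ (i + j) u x‖ ≤
      A * Real.exp (a * 2) * C₂ * (j + n + 2) * norms ω (j + n + 1) χ := by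
    intro i hi
    have hi' : i + j ≤ j + n + 1 := by have := Finset.mem_range.1 hi; omega
    have hpt (x : Rn n) : ω t * ‖iteratedFDeriv ℝ (i + j) u x‖ ≤ A * Real.exp (a * 2) * C₂ *
        ∑ l ∈ Finset.range (j + n + 1 + 1), ω x * ‖iteratedFDeriv ℝ l χ x‖ := by
      have hx0 := ω.pos' x
      by_cases hx : x ∈ tsupport u
      · have h1 : ‖t - x‖ ≤ 2 := by
          have h2 : tsupport u ⊆ Metric.closedBall t 2 := by
            refine closure_minimal (fun y hy => ?_) Metric.isClosed_closedBall
            have h3 : b (y - t) ≠ 0 := fun h => hy (by simp [hu, h])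
            have h4 : y - t ∈ Metric.ball (0 : Rn n) 2 := b.support_eq ▸ h3
            rw [mem_closedBall_iff_norm]
            exact (mem_ball_zero_iff.1 h4).le
          rw [norm_sub_rev]
          exact mem_closedBall_iff_norm.1 (h2 hx)
        have h2 := hω (t - x) x
        rw [sub_add_cancel] at h2
        calc _ ≤ (A * ω x * Real.exp (a * ‖t - x‖)) * (C₂ * ∑ l ∈ Finset.range (j + n + 1 + 1),
                ‖iteratedFDeriv ℝ l χ x‖) := by
              gcongr
              exact H₂ t χ χ.2.1 (i + j) hi' x
          _ ≤ (A * ω x * Real.exp (a * 2)) * (C₂ * ∑ l ∈ Finset.range (j + n + 1 + 1),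
                ‖iteratedFDeriv ℝ l χ x‖) := by gcongr
          _ = _ := by rw [← Finset.mul_sum]; ring
      · have h1 : iteratedFDeriv ℝ (i + j) u x = 0 := by
          by_contra h
          exact hx (support_iteratedFDeriv_subset _ h)
        rw [h1, norm_zero, mul_zero]
        positivity
    have hint : Integrable fun x => ‖iteratedFDeriv ℝ (i + j) u x‖ :=
      ((hus.continuous_iteratedFDeriv (mod_cast le_top)).integrable_of_hasCompactSupport
        (huc.iteratedFDeriv (𝕜 := ℝ) _)).norm
    rw [← integral_const_mul]
    refine (integral_mono (hint.const_mul _) ((integrable_finsetSum _ fun l _ =>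
      integrable_weight_mul l χ).const_mul _) hpt).trans ?_
    rw [integral_const_mul, integral_finsetSum _ fun l _ => integrable_weight_mul l χ, mul_assoc _ ((j : ℝ) + n + 2)]
    refine mul_le_mul_of_nonneg_left ?_ (by positivity)
    calc _ ≤ ∑ _l ∈ Finset.range (j + n + 1 + 1), norms ω (j + n + 1) χ := by
          refine Finset.sum_le_sum fun l hl => ?_
          rw [← weightedInt_apply]
          exact weightedInt_le_norms (Nat.lt_succ_iff.1 (Finset.mem_range.1 hl)) χ
      _ = _ := by rw [Finset.sum_const, Finset.card_range, nsmul_eq_mul]; push_cast; ring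
  have ht0 := ω.pos' t
  calc _ ≤ ω t * (C₁ * ∑ i ∈ Finset.range (n + 2), ∫ x, ‖iteratedFDeriv ℝ (i + j) u x‖) := by
        gcongr
    _ = C₁ * ∑ i ∈ Finset.range (n + 2), ω t * ∫ x, ‖iteratedFDeriv ℝ (i + j) u x‖ := by
        rw [mul_left_comm, Finset.mul_sum]
    _ ≤ C₁ * ∑ i ∈ Finset.range (n + 2),
          (A * Real.exp (a * 2) * C₂ * (j + n + 2) * norms ω (j + n + 1) χ) := by
        exact mul_le_mul_of_nonneg_left (Finset.sum_le_sum hi) hC₁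
    _ = _ := by simp; ring

/-- The map `χ ↦ ω D^j χ(v₁, …, v_j)` from `D_{L¹_ω}` to `L²`. -/
theorem exists_toL2 (ω : Weight n) (j : ℕ) (v : Fin j → Rn n) :
    ∃ T : DL1 ω →L[ℂ] Lp ℂ 2 (volume : Measure (Rn n)), ∀ χ : DL1 ω,
      T χ =ᵐ[volume] fun t => (ω t : ℂ) * iteratedFDeriv ℝ j χ t v := by
  obtain ⟨C, hC, H⟩ := exists_weight_mul_norm_le ω j
  set p := ∏ i, ‖v i‖ with hp
  have hp0 : 0 ≤ p := Finset.prod_nonneg fun _ _ => norm_nonneg _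
  -- Of the two factors of the square, one is bounded by the Sobolev inequality and the other is
  -- integrable.
  have hpt (χ : DL1 ω) (t : Rn n) : ‖(ω t : ℂ) * iteratedFDeriv ℝ j χ t v‖ ^ 2 ≤
      p ^ 2 * (C * norms ω (j + n + 1) χ) * (ω t * ‖iteratedFDeriv ℝ j χ t‖) := by
    have ht0 := ω.pos' t
    have h1 : ‖(ω t : ℂ) * iteratedFDeriv ℝ j χ t v‖ ≤ p * (ω t * ‖iteratedFDeriv ℝ j χ t‖) := by
      rw [norm_mul, Complex.norm_real, Real.norm_eq_abs, abs_of_pos ht0]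
      calc _ ≤ ω t * (‖iteratedFDeriv ℝ j χ t‖ * p) := by
            gcongr; exact ContinuousMultilinearMap.le_opNorm _ _
        _ = _ := by ring
    calc _ ≤ (p * (ω t * ‖iteratedFDeriv ℝ j χ t‖)) ^ 2 := by gcongr
      _ = p ^ 2 * (ω t * ‖iteratedFDeriv ℝ j χ t‖) * (ω t * ‖iteratedFDeriv ℝ j χ t‖) := by ring
      _ ≤ _ := mul_le_mul_of_nonneg_right
          (mul_le_mul_of_nonneg_left (H χ t) (by positivity)) (by positivity)
  have hmeas (χ : DL1 ω) : AEStronglyMeasurable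
      (fun t => (ω t : ℂ) * iteratedFDeriv ℝ j χ t v) (volume : Measure (Rn n)) := by
    have h1 : Continuous fun t => iteratedFDeriv ℝ j χ t v :=
      (χ.2.1.continuous_iteratedFDeriv (m := j) (mod_cast le_top)).eval_const v
    exact ((Complex.measurable_ofReal.comp ω.measurable').mul h1.measurable).aestronglyMeasurable
  have hint (χ : DL1 ω) : Integrable fun t => ‖(ω t : ℂ) * iteratedFDeriv ℝ j χ t v‖ ^ 2 :=
    ((integrable_weight_mul j χ).const_mul _).mono' ((hmeas χ).norm.pow 2)
      (ae_of_all _ fun t => by rw [Real.norm_eq_abs, abs_of_nonneg (by positivity)]; exact hpt χ t)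
  have hmem (χ : DL1 ω) : MemLp (fun t => (ω t : ℂ) * iteratedFDeriv ℝ j χ t v) 2
      (volume : Measure (Rn n)) := (memLp_two_iff_integrable_sq_norm (hmeas χ)).2 (hint χ)
  let L : DL1 ω →ₗ[ℂ] Lp ℂ 2 (volume : Measure (Rn n)) :=
    { toFun := fun χ => (hmem χ).toLp _
      map_add' := fun φ χ => by
        rw [← MemLp.toLp_add]
        congr 1
        ext t
        have h : iteratedFDeriv ℝ j (φ + χ : DL1 ω) t
            = iteratedFDeriv ℝ j φ t + iteratedFDeriv ℝ j χ t :=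
          iteratedFDeriv_add_apply (φ.2.1.of_le (mod_cast le_top)).contDiffAt
            (χ.2.1.of_le (mod_cast le_top)).contDiffAt
        simp only [h, Pi.add_apply, add_apply, mul_add]
      map_smul' := fun c χ => by
        rw [RingHom.id_apply, ← MemLp.toLp_const_smul]
        congr 1
        ext t
        have h : iteratedFDeriv ℝ j (c • χ : DL1 ω) t = c • iteratedFDeriv ℝ j χ t :=
          iteratedFDeriv_const_smul_apply (χ.2.1.of_le (mod_cast le_top)).contDiffAt
        simp only [h, Pi.smul_apply, smul_apply, smul_eq_mul]
        ring }
  have hL (χ : DL1 ω) : ‖L χ‖ ≤ p * Real.sqrt C * norms ω (j + n + 1) χ := by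
    have hae : (L χ : Rn n → ℂ) =ᵐ[volume] fun t => (ω t : ℂ) * iteratedFDeriv ℝ j χ t v :=
      (hmem χ).coeFn_toLp
    have h1 : ‖L χ‖ ^ 2 = ∫ t, ‖(ω t : ℂ) * iteratedFDeriv ℝ j χ t v‖ ^ 2 := by
      rw [← inner_self_eq_norm_sq (𝕜 := ℂ), L2.inner_def, ← integral_re (L2.integrable_inner _ _)]
      refine integral_congr_ae (hae.mono fun t ht => ?_)
      simp only [ht]
      exact inner_self_eq_norm_sq _
    have h0 : 0 ≤ norms ω (j + n + 1) χ := apply_nonneg _ _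
    refine le_of_sq_le_sq ?_ (by positivity)
    rw [h1]
    refine (integral_mono (hint χ) ((integrable_weight_mul j χ).const_mul _) (hpt χ)).trans ?_
    rw [integral_const_mul, ← weightedInt_apply]
    calc _ ≤ p ^ 2 * (C * norms ω (j + n + 1) χ) * norms ω (j + n + 1) χ := by
          gcongr; exact weightedInt_le_norms (by omega) χ
      _ = _ := by rw [mul_pow, mul_pow, Real.sq_sqrt hC]; ring
  refine ⟨⟨L, WithSeminorms.continuous_of_isBounded (withSeminorms ω) (norm_withSeminorms ℂ _) L
    fun _ => ?_⟩, fun χ => (hmem χ).coeFn_toLp⟩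
  refine ⟨{j + n + 1}, ⟨p * Real.sqrt C, by positivity⟩, fun χ => ?_⟩
  rw [Finset.sup_singleton]
  exact hL χ

end DL1

/-! ### Coefficients of derivatives and integration by parts. -/

/-- The norm of a multilinear map on `ℝⁿ` is bounded by the sum of its coefficients. -/
theorem norm_le_sum_norm_apply_single {j : ℕ} {F : Type*} [NormedAddCommGroup F] [NormedSpace ℝ F]
    (M : Rn n [×j]→L[ℝ] F) :
    ‖M‖ ≤ ∑ v : Fin j → Fin n, ‖M fun i => EuclideanSpace.single (v i) (1 : ℝ)‖ := by
  refine ContinuousMultilinearMap.opNorm_le_bound (by positivity) fun m => ?_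
  have hm : m = fun i => ∑ l, m i l • EuclideanSpace.single l (1 : ℝ) := by
    ext i l
    simp [Finset.sum_apply, Pi.single_apply]
  have h : M m = ∑ v : Fin j → Fin n, (∏ i, m i (v i)) •
      M fun i => EuclideanSpace.single (v i) (1 : ℝ) := by
    conv_lhs => rw [hm]
    rw [ContinuousMultilinearMap.map_sum]
    refine Finset.sum_congr rfl fun v _ => ?_
    exact M.map_smul_univ (fun i => m i (v i)) _
  rw [h, Finset.sum_mul]
  refine (norm_sum_le _ _).trans (Finset.sum_le_sum fun v _ => ?_)
  rw [norm_smul, mul_comm, norm_prod]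
  gcongr with i
  exact PiLp.norm_apply_le (m i) (v i)

/-- Integration by parts moves a derivative of any order to the test function. -/
theorem exists_integral_mul_iteratedFDeriv_eq (j : ℕ) (v : Fin j → Rn n) {ψ : Rn n → ℂ}
    (hψ : ContDiff ℝ (⊤ : ℕ∞) ψ) (hs : HasCompactSupport ψ) :
    ∃ φ : 𝓓((⊤ : Opens (Rn n)), ℂ), ∀ χ : Rn n → ℂ, ContDiff ℝ (⊤ : ℕ∞) χ →
      ∫ t, ψ t * iteratedFDeriv ℝ j χ t v = ∫ t, φ t * χ t := by
  induction j generalizing ψ with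
  | zero => exact ⟨⟨ψ, hψ, hs, Set.subset_univ _⟩, fun χ _ => by simp⟩
  | succ j ih =>
    have hψ' : ContDiff ℝ (⊤ : ℕ∞) fun t => -(fderiv ℝ ψ t (v 0)) :=
      ((hψ.fderiv_right (m := (⊤ : ℕ∞)) (by simp)).clm_apply contDiff_const).neg
    -- The derivative in the direction `v 0` is taken last, hence is the first to be moved: `ψ`
    -- becomes `-∂_{v 0} ψ`. The resulting `φ` does not depend on `χ`.
    obtain ⟨φ, hφ⟩ := ih (fun i => v i.succ) hψ' (hs.fderiv_apply (𝕜 := ℝ) (v 0)).neg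
    refine ⟨φ, fun χ hχ => ?_⟩
    rw [← hφ χ hχ]
    set g : Rn n → ℂ := fun t => iteratedFDeriv ℝ j χ t fun i => v i.succ with hg
    have hgs : ContDiff ℝ (⊤ : ℕ∞) g :=
      (ContinuousMultilinearMap.apply ℝ (fun _ : Fin j => Rn n) ℂ fun i => v i.succ).contDiff.comp
        (hχ.iteratedFDeriv_right (m := (⊤ : ℕ∞)) (i := j) (mod_cast le_top))
    have hd (t : Rn n) : iteratedFDeriv ℝ (j + 1) χ t v = fderiv ℝ g t (v 0) := by
      rw [iteratedFDeriv_succ_apply_left, hg]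
      have hdiff : DifferentiableAt ℝ (iteratedFDeriv ℝ j χ) t :=
        (hχ.iteratedFDeriv_right (m := (⊤ : ℕ∞)) (i := j) (mod_cast le_top)).differentiable (by simp) t
      have := ((ContinuousMultilinearMap.apply ℝ (fun _ : Fin j => Rn n) ℂ
        fun i => v i.succ).hasFDerivAt.comp t hdiff.hasFDerivAt).fderiv
      exact (congrArg (fun L => L (v 0)) this).symm
    have hc1 : Continuous fun t => fderiv ℝ ψ t (v 0) :=
      (hψ.continuous_fderiv (by simp)).clm_apply continuous_const
    have hc2 : Continuous fun t => fderiv ℝ g t (v 0) :=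
      (hgs.continuous_fderiv (by simp)).clm_apply continuous_const
    simp only [hd]
    rw [integral_mul_fderiv_eq_neg_fderiv_mul_of_integrable]
    · simp only [neg_mul, integral_neg]; rfl
    · exact (hc1.mul hgs.continuous).integrable_of_hasCompactSupport
        (hs.fderiv_apply (𝕜 := ℝ) (v 0)).mul_right
    · exact (hψ.continuous.mul hc2).integrable_of_hasCompactSupport hs.mul_right
    · exact (hψ.continuous.mul hgs.continuous).integrable_of_hasCompactSupport hs.mul_right
    · exact fun t _ => hψ.differentiable (by simp) t
    · exact fun t _ => hgs.differentiable (by simp) t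

/-! ### Smooth exponential weights -/

theorem norm_le_sqrt_one_add_norm_sq {E : Type*} [NormedAddCommGroup E] (t : E) :
    ‖t‖ ≤ Real.sqrt (1 + ‖t‖ ^ 2) :=
  Real.le_sqrt_of_sq_le (by linarith)

theorem contDiff_sqrt_one_add_norm_sq {E : Type*} [NormedAddCommGroup E] [InnerProductSpace ℝ E] :
    ContDiff ℝ (⊤ : ℕ∞) fun t : E => Real.sqrt (1 + ‖t‖ ^ 2) :=
  (contDiff_const.add (contDiff_norm_sq ℝ)).sqrt fun t => by positivity

/-- The weight `exp (k √(1 + |t|²))`. -/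
noncomputable def expWeight (n k : ℕ) : Weight n where
  -- The square root replaces `|t|` for smoothness at the origin: the weight becomes a factor of a
  -- test function when integrating by parts.
  toFun t := Real.exp (k * Real.sqrt (1 + ‖t‖ ^ 2))
  measurable' := by fun_prop
  pos' _ := Real.exp_pos _
  moderate' := by
    refine ⟨Real.exp k, k, Real.exp_pos _, Nat.cast_nonneg _, fun x y => ?_⟩
    rw [← Real.exp_add, ← Real.exp_add, Real.exp_le_exp]
    have h : Real.sqrt (1 + ‖x + y‖ ^ 2) ≤ 1 + Real.sqrt (1 + ‖y‖ ^ 2) + ‖x‖ := by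
      rw [Real.sqrt_le_left (by positivity)]
      have h1 := norm_add_le x y
      have h2 := norm_le_sqrt_one_add_norm_sq y
      calc 1 + ‖x + y‖ ^ 2 ≤ (1 + ‖x + y‖) ^ 2 := by nlinarith [norm_nonneg (x + y)]
        _ ≤ _ := pow_le_pow_left₀ (by positivity) (by linarith) 2
    calc _ ≤ (k : ℝ) * (1 + Real.sqrt (1 + ‖y‖ ^ 2) + ‖x‖) := by gcongr
      _ = _ := by ring

theorem contDiff_expWeight (n k : ℕ) : ContDiff ℝ (⊤ : ℕ∞) (expWeight n k) :=
  (contDiff_const.mul contDiff_sqrt_one_add_norm_sq).exp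

theorem expWeight_mul_exp_neg (k : ℕ) (t : Rn n) :
    Real.exp (-Real.sqrt (1 + ‖t‖ ^ 2)) * expWeight n (k + 1) t = expWeight n k t := by
  change Real.exp _ * Real.exp _ = Real.exp _
  rw [← Real.exp_add]
  congr 1
  push_cast
  ring

theorem expWeight_le_succ (k : ℕ) (t : Rn n) : expWeight n k t ≤ expWeight n (k + 1) t := by
  rw [← expWeight_mul_exp_neg]
  refine mul_le_of_le_one_left ((expWeight n (k + 1)).pos' t).le ?_
  rw [Real.exp_le_one_iff]
  exact neg_nonpos.2 (Real.sqrt_nonneg _)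

theorem memLp_two_exp_neg : MemLp (fun t : Rn n => Real.exp (-Real.sqrt (1 + ‖t‖ ^ 2))) 2 := by
  refine (memLp_two_iff_integrable_sq_norm
    (contDiff_sqrt_one_add_norm_sq.neg.exp.continuous.aestronglyMeasurable)).2 ?_
  refine integrable_exp_neg_norm.mono' (by fun_prop) (ae_of_all _ fun t => ?_)
  rw [Real.norm_eq_abs, abs_of_nonneg (by positivity), Real.norm_eq_abs,
    abs_of_pos (Real.exp_pos _), ← Real.exp_nat_mul, Real.exp_le_exp]
  have h := norm_le_sqrt_one_add_norm_sq t
  push_cast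
  linarith [norm_nonneg t]

theorem integral_norm_smul_le_of_memLp_two {α F : Type*} [MeasurableSpace α] {μ : Measure α}
    [NormedAddCommGroup F] [NormedSpace ℝ F] {g : α → ℝ} {h : α → F}
    (hg : MemLp g 2 μ) (hh : MemLp h 2 μ) :
    ∫ t, ‖g t • h t‖ ∂μ ≤ (eLpNorm g 2 μ).toReal * (eLpNorm h 2 μ).toReal := by
  have h1 : eLpNorm (g • h) 1 μ ≤ eLpNorm g 2 μ * eLpNorm h 2 μ :=
    eLpNorm_smul_le_mul_eLpNorm hh.1 hg.1
  change ∫ t, ‖(g • h) t‖ ∂μ ≤ _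
  rw [integral_norm_eq_lintegral_enorm (hg.1.smul hh.1), ← ENNReal.toReal_mul,
    ← eLpNorm_one_eq_lintegral_enorm]
  exact ENNReal.toReal_mono (ENNReal.mul_ne_top hg.2.ne hh.2.ne) h1

namespace DL1

theorem coe_mk {ω : Weight n} (g : Rn n → ℂ) (hg : g ∈ DL1Submodule ω) :
    ((⟨g, hg⟩ : DL1Submodule ω) : Rn n → ℂ) = g := rfl

/-- The inclusion of `D_{L¹_ω}` in the corresponding space for a smaller weight. -/
noncomputable def ofLE {ω₁ ω₂ : Weight n} (hω : ∀ t, ω₁ t ≤ ω₂ t) (χ : DL1 ω₂) : DL1 ω₁ :=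
  ⟨χ.1, χ.2.1, fun j => by
    have h := χ.2.2 j
    have hc := χ.2.1.continuous_iteratedFDeriv (m := j) (mod_cast le_top)
    rw [Weight.integrable_iff] at h ⊢
    refine h.norm.mono' (ω₁.measurable'.aestronglyMeasurable.smul hc.aestronglyMeasurable)
      (ae_of_all _ fun t => ?_)
    rw [norm_smul, norm_smul]
    gcongr
    exact abs_le_abs_of_nonneg (ω₁.pos' t).le (hω t)⟩

theorem coe_ofLE {ω₁ ω₂ : Weight n} (hω : ∀ t, ω₁ t ≤ ω₂ t) (χ : DL1 ω₂) :
    (ofLE hω χ : Rn n → ℂ) = χ := coe_mk χ.1 _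

/-- The seminorms of `D_{L¹_ω}` are bounded by the components of `ω' D^j χ` in `L²` for the next
exponential weight `ω'`. -/
theorem weightedInt_ofLE_le (n j : ℕ) : ∃ C : ℝ, 0 ≤ C ∧
    ∀ (k : ℕ) (T : (Fin j → Fin n) → DL1 (expWeight n (k + 1)) → Lp ℂ 2 (volume : Measure (Rn n))),
      (∀ v χ, T v χ =ᵐ[volume] fun t => (expWeight n (k + 1) t : ℂ) *
        iteratedFDeriv ℝ j χ t fun i => EuclideanSpace.single (v i) (1 : ℝ)) →
      ∀ χ, weightedInt (expWeight n k) j (ofLE (expWeight_le_succ k) χ) ≤ C * ∑ v, ‖T v χ‖ := by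
  -- Since `g` times the weight for `k + 1` is the weight for `k`, Cauchy–Schwarz bounds the
  -- weighted `L¹` norm by `L²` norms for the next weight, with a constant free of `k`.
  set g : Rn n → ℝ := fun t => Real.exp (-Real.sqrt (1 + ‖t‖ ^ 2)) with hg
  refine ⟨(eLpNorm g 2 volume).toReal, ENNReal.toReal_nonneg, fun k T hT χ => ?_⟩
  have hgm : MemLp g 2 (volume : Measure (Rn n)) := memLp_two_exp_neg
  have hi (v : Fin j → Fin n) : Integrable fun t => ‖g t • T v χ t‖ :=
    (memLp_one_iff_integrable.1 ((Lp.memLp (T v χ)).smul (r := 1) hgm)).norm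
  have hχ := integrable_weight_mul j (ofLE (expWeight_le_succ k) χ)
  rw [coe_ofLE] at hχ
  rw [weightedInt_apply, coe_ofLE]
  calc ∫ t, expWeight n k t * ‖iteratedFDeriv ℝ j χ t‖
      ≤ ∫ t, ∑ v : Fin j → Fin n, ‖g t • T v χ t‖ := by
        refine integral_mono_ae hχ
          (integrable_finsetSum _ fun v _ => hi v) ?_
        filter_upwards [eventually_countable_forall.2 fun v => hT v χ] with t ht
        have h1 := (expWeight n (k + 1)).pos' t
        have h2 := (expWeight n k).pos' t
        calc _ ≤ expWeight n k t * ∑ v : Fin j → Fin n,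
              ‖iteratedFDeriv ℝ j χ t fun i => EuclideanSpace.single (v i) (1 : ℝ)‖ := by
              gcongr; exact norm_le_sum_norm_apply_single _
          _ = _ := by
              rw [Finset.mul_sum]
              refine Finset.sum_congr rfl fun v _ => ?_
              rw [ht v, norm_smul, norm_mul, Complex.norm_real, Real.norm_eq_abs, Real.norm_eq_abs,
                abs_of_pos h1, abs_of_pos (Real.exp_pos _), ← mul_assoc, expWeight_mul_exp_neg]
    _ = ∑ v : Fin j → Fin n, ∫ t, ‖g t • T v χ t‖ := integral_finsetSum _ fun v _ => hi v
    _ ≤ ∑ v : Fin j → Fin n, (eLpNorm g 2 volume).toReal * ‖T v χ‖ := by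
        refine Finset.sum_le_sum fun v _ => ?_
        exact integral_norm_smul_le_of_memLp_two hgm (Lp.memLp (T v χ))
    _ = _ := (Finset.mul_sum _ _ _).symm

end DL1

/-! ### Extension of functionals -/

/-- A linear functional dominated by `‖T ·‖` factors through `T`. -/
theorem exists_factor_of_norm_le {𝕜 V H : Type*} [RCLike 𝕜] [AddCommGroup V] [Module 𝕜 V]
    [NormedAddCommGroup H] [NormedSpace 𝕜 H] (T : V →ₗ[𝕜] H) (g : V →ₗ[𝕜] 𝕜) (C : ℝ)
    (h : ∀ v, ‖g v‖ ≤ C * ‖T v‖) : ∃ G : H →L[𝕜] 𝕜, ∀ v, G (T v) = g v := by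
  -- The bound forces `g` to vanish on the kernel of `T`, so `g` descends to the range of `T`;
  -- Hahn–Banach extends it from there.
  have hker : LinearMap.ker T.rangeRestrict ≤ LinearMap.ker g := fun v hv => by
    rw [LinearMap.ker_rangeRestrict, LinearMap.mem_ker] at hv
    simpa [hv] using h v
  obtain ⟨r, hr⟩ := T.rangeRestrict.exists_rightInverse_of_surjective T.range_rangeRestrict
  have hgr (v : V) : g (r (T.rangeRestrict v)) = g v := by
    rw [← sub_eq_zero, ← map_sub]
    refine LinearMap.mem_ker.1 (hker ?_)
    rw [LinearMap.mem_ker, map_sub, sub_eq_zero]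
    exact LinearMap.congr_fun hr _
  let G₀ : StrongDual 𝕜 (LinearMap.range T) := (g ∘ₗ r).mkContinuous C fun y => by
    obtain ⟨v, rfl⟩ := T.surjective_rangeRestrict y
    change ‖g (r (T.rangeRestrict v))‖ ≤ _
    rw [hgr]
    exact h v
  obtain ⟨G, hG, -⟩ := exists_extension_norm_eq (LinearMap.range T) G₀
  exact ⟨G, fun v => (hG (T.rangeRestrict v)).trans (hgr v)⟩

/-! ### Complex-linear extension of a distribution. -/

section Complexify

variable {ω : Weight n}

/-- The real and imaginary parts of compactly supported functions, as test functions. -/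
noncomputable def partTest (L : ℂ →L[ℝ] ℝ) (χ : DL1 ω) (hχ : HasCompactSupport χ) :
    𝓓((⊤ : Opens (Rn n)), ℝ) :=
  ⟨fun t => L (χ t), L.contDiff.comp χ.2.1, hχ.comp_left (map_zero L), Set.subset_univ _⟩

/-- The compactly supported elements of `D_{L¹_ω}`. -/
def compactlySupported (ω : Weight n) : Submodule ℂ (DL1 ω) where
  carrier := {χ | HasCompactSupport χ}
  zero_mem' := HasCompactSupport.zero
  add_mem' h₁ h₂ := HasCompactSupport.add h₁ h₂
  smul_mem' c _ h := HasCompactSupport.smul_left (f := fun _ => c) h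

/-- The complex-linear extension of a distribution to complex-valued test functions. -/
noncomputable def complexify (ω : Weight n) (f : 𝓓'((⊤ : Opens (Rn n)), ℂ)) :
    compactlySupported ω →ₗ[ℂ] ℂ where
  toFun χ := f (partTest Complex.reCLM χ.1 χ.2) + Complex.I * f (partTest Complex.imCLM χ.1 χ.2)
  map_add' χ₁ χ₂ := by
    have h (L : ℂ →L[ℝ] ℝ) : partTest L (χ₁ + χ₂).1 (χ₁ + χ₂).2
        = partTest L χ₁.1 χ₁.2 + partTest L χ₂.1 χ₂.2 := by
      ext t
      exact map_add L (χ₁.1 t) (χ₂.1 t)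
    rw [h, h, map_add, map_add]
    ring
  map_smul' c χ := by
    have h1 : partTest Complex.reCLM (c • χ).1 (c • χ).2
        = c.re • partTest Complex.reCLM χ.1 χ.2 - c.im • partTest Complex.imCLM χ.1 χ.2 := by
      ext t
      exact Complex.mul_re c (χ.1 t)
    have h2 : partTest Complex.imCLM (c • χ).1 (c • χ).2
        = c.re • partTest Complex.imCLM χ.1 χ.2 + c.im • partTest Complex.reCLM χ.1 χ.2 := by
      ext t
      exact Complex.mul_im c (χ.1 t)
    rw [h1, h2, map_sub, map_add, map_smul, map_smul, map_smul, map_smul]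
    simp only [Complex.real_smul, RingHom.id_apply, smul_eq_mul]
    conv_rhs => rw [← Complex.re_add_im c]
    linear_combination (-(c.im : ℂ) * f (partTest Complex.imCLM χ.1 χ.2)) * Complex.I_mul_I

theorem complexify_ofTest (f : 𝓓'((⊤ : Opens (Rn n)), ℂ)) (φ : 𝓓((⊤ : Opens (Rn n)), ℝ)) :
    ∃ h, complexify ω f ⟨DL1.ofTest ω φ, h⟩ = f φ := by
  have h : HasCompactSupport (DL1.ofTest ω φ) :=
    φ.hasCompactSupport.comp_left Complex.ofReal_zero
  refine ⟨h, ?_⟩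
  have h1 : partTest Complex.reCLM (DL1.ofTest ω φ) h = φ := by
    ext t
    exact Complex.ofReal_re (φ t)
  have h2 : partTest Complex.imCLM (DL1.ofTest ω φ) h = 0 := by
    ext t
    exact Complex.ofReal_im (φ t)
  change f (partTest Complex.reCLM (DL1.ofTest ω φ) h) +
    Complex.I * f (partTest Complex.imCLM (DL1.ofTest ω φ) h) = _
  rw [h1, h2, map_zero, mul_zero, add_zero]

theorem norm_iteratedFDeriv_partTest_le {L : ℂ →L[ℝ] ℝ} (hL : ‖L‖ ≤ 1) (χ : DL1 ω)
    (hχ : HasCompactSupport χ) (j : ℕ) (t : Rn n) :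
    ‖iteratedFDeriv ℝ j (partTest L χ hχ) t‖ ≤ ‖iteratedFDeriv ℝ j χ t‖ := by
  refine (L.norm_iteratedFDeriv_comp_left χ.2.1.contDiffAt (n := j) (mod_cast le_top)).trans ?_
  exact mul_le_of_le_one_left (norm_nonneg _) hL

theorem norm_complexify_le {f : 𝓓'((⊤ : Opens (Rn n)), ℂ)} {N k : ℕ} {C : ℝ}
    (h : ∀ (φ : 𝓓((⊤ : Opens (Rn n)), ℝ)) (P : ℝ),
      (∀ j ≤ N, ∀ t, Real.exp (k * ‖t‖) * ‖iteratedFDeriv ℝ j φ t‖ ≤ P) → ‖f φ‖ ≤ C * P)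
    (χ : compactlySupported ω) (P : ℝ)
    (hP : ∀ j ≤ N, ∀ t, Real.exp (k * ‖t‖) * ‖iteratedFDeriv ℝ j χ.1 t‖ ≤ P) :
    ‖complexify ω f χ‖ ≤ 2 * C * P := by
  have h1 {L : ℂ →L[ℝ] ℝ} (hL : ‖L‖ ≤ 1) : ‖f (partTest L χ.1 χ.2)‖ ≤ C * P :=
    h _ _ fun j hj t => le_trans
      (by gcongr; exact norm_iteratedFDeriv_partTest_le hL _ _ _ _) (hP j hj t)
  refine (norm_add_le _ _).trans ?_
  rw [norm_mul, Complex.norm_I, one_mul]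
  linarith [h1 Complex.reCLM_norm.le, h1 Complex.imCLM_norm.le]

end Complexify

/-! ### The closure of the test functions in the dual of `D_{L¹_ω}` -/

theorem add_mem_testFunctionals {ω : Weight n} {F G : DL1 ω →L[ℂ] ℂ} (hF : F ∈ testFunctionals ω)
    (hG : G ∈ testFunctionals ω) : F + G ∈ testFunctionals ω := by
  obtain ⟨φ, hφ⟩ := hF
  obtain ⟨ψ, hψ⟩ := hG
  refine ⟨φ + ψ, fun χ => ?_⟩
  have h (φ : 𝓓((⊤ : Opens (Rn n)), ℂ)) : Integrable fun t => φ t * χ t :=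
    (φ.continuous.mul χ.2.1.continuous).integrable_of_hasCompactSupport
      φ.hasCompactSupport.mul_right
  rw [add_apply, hφ, hψ, ← integral_add (h φ) (h ψ)]
  refine integral_congr_ae (ae_of_all _ fun t => ?_)
  exact (add_mul (φ t) (ψ t) (χ t)).symm

/-- The test functionals form an additive submonoid, and the closure of a submonoid is again one
because addition in the strong dual is continuous. -/
theorem sum_mem_closure_testFunctionals {ω : Weight n} {ι : Type*} (s : Finset ι)
    (F : ι → DL1 ω →L[ℂ] ℂ) (hF : ∀ i ∈ s, F i ∈ closure (testFunctionals ω)) :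
    ∑ i ∈ s, F i ∈ closure (testFunctionals ω) := by
  have := (DL1.withSeminorms ω).topologicalAddGroup
  let M : AddSubmonoid (DL1 ω →L[ℂ] ℂ) :=
    { carrier := testFunctionals ω
      zero_mem' := ⟨0, fun χ => by simp⟩
      add_mem' := add_mem_testFunctionals }
  exact M.topologicalClosure.sum_mem hF

/-- Functionals of the form `χ ↦ G (ω D^j χ(v₁, …, v_j))` with `G` in the dual of `L²` are limits
of test functions, if `ω` is smooth. -/
theorem comp_mem_closure_testFunctionals {ω : Weight n} (hω : ContDiff ℝ (⊤ : ℕ∞) ω) {j : ℕ}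
    {v : Fin j → Rn n} {T : DL1 ω →L[ℂ] Lp ℂ 2 (volume : Measure (Rn n))}
    (hT : ∀ χ : DL1 ω, T χ =ᵐ[volume] fun t => (ω t : ℂ) * iteratedFDeriv ℝ j χ t v)
    (G : Lp ℂ 2 (volume : Measure (Rn n)) →L[ℂ] ℂ) :
    G.comp T ∈ closure (testFunctionals ω) := by
  have := (DL1.withSeminorms ω).topologicalAddGroup
  have := (DL1.withSeminorms ω).continuousSMul
  set D := InnerProductSpace.toDual ℂ (Lp ℂ 2 (volume : Measure (Rn n)))
  -- `Φ` is continuous from `L²` to the strong dual, so it carries the density of test functions in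
  -- `L²` to the desired approximation.
  let Φ : Lp ℂ 2 (volume : Measure (Rn n)) → DL1 ω →L[ℂ] ℂ := fun y => (D y).comp T
  have hΦ : Continuous Φ := (ContinuousLinearMap.precomp ℂ T).continuous.comp D.continuous
  let S : Set (Lp ℂ 2 (volume : Measure (Rn n))) :=
    {y | ∃ ψ : Rn n → ℂ, HasCompactSupport ψ ∧ ContDiff ℝ (⊤ : ℕ∞) ψ ∧ y =ᵐ[volume] ψ}
  have hS : D.symm G ∈ closure S := by
    refine (mem_closure_iff_nhds_basis Metric.nhds_basis_closedBall).2 fun ε hε => ?_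
    obtain ⟨ψ, h1, h2, h3⟩ := MemLp.exist_eLpNorm_sub_le (by simp) (by norm_num)
      (Lp.memLp (D.symm G)) hε
    have hψ : MemLp ψ 2 (volume : Measure (Rn n)) := h2.continuous.memLp_of_hasCompactSupport h1
    refine ⟨hψ.toLp ψ, ⟨ψ, h1, h2, hψ.coeFn_toLp⟩, ?_⟩
    rw [Metric.mem_closedBall', Lp.dist_def,
      eLpNorm_congr_ae (Filter.EventuallyEq.rfl.sub hψ.coeFn_toLp)]
    exact ENNReal.toReal_le_of_le_ofReal hε.le h3
  have h := map_mem_closure hΦ hS (t := testFunctionals ω) ?_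
  · simpa [Φ] using h
  rintro y ⟨ψ, h1, h2, hy⟩
  -- The conjugate appears because the inner product is conjugate-linear in its first argument.
  obtain ⟨φ, hφ⟩ := exists_integral_mul_iteratedFDeriv_eq j v
    (ψ := fun t => (starRingEnd ℂ) (ψ t) * (ω t : ℂ))
    ((Complex.conjCLE.contDiff.comp h2).mul (Complex.ofRealCLM.contDiff.comp hω))
    (h1.comp_left (map_zero (starRingEnd ℂ))).mul_right
  refine ⟨φ, fun χ => ?_⟩
  rw [← hφ χ χ.2.1]
  change inner ℂ y (T χ) = _
  rw [L2.inner_def]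
  refine integral_congr_ae ?_
  filter_upwards [hy, hT χ] with t ht1 ht2
  rw [ht1, ht2, RCLike.inner_apply]
  ring

/-- A distribution that is continuous for one of the norms of `K₁` belongs to `Ḃ'_ω` for some
exponential weight `ω`. -/
theorem mem_BDotDual_of_norm_apply_le {f : 𝓓'((⊤ : Opens (Rn n)), ℂ)} {N k : ℕ} {C : ℝ}
    (hf : ∀ (φ : 𝓓((⊤ : Opens (Rn n)), ℝ)) (P : ℝ),
      (∀ j ≤ N, ∀ t, Real.exp (k * ‖t‖) * ‖iteratedFDeriv ℝ j φ t‖ ≤ P) → ‖f φ‖ ≤ C * P) :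
    f ∈ BDotDual (expWeight n (k + 1)) := by
  set ω := expWeight n (k + 1) with hω
  let e {j : ℕ} (v : Fin j → Fin n) : Fin j → Rn n := fun i => EuclideanSpace.single (v i) (1 : ℝ)
  choose T hT using fun (j : ℕ) (v : Fin j → Fin n) => DL1.exists_toL2 ω j (e v)
  choose A hA hA' using fun j => DL1.exists_weight_mul_norm_le (expWeight n k) j
  choose B hB hB' using fun j => DL1.weightedInt_ofLE_le n j
  -- One component for each derivative of order at most `N + n + 1`: the order `N` of `f`, and `n +
  -- 1` for the Sobolev inequality.
  let ι := Σ j : Fin (N + n + 1 + 1), Fin j → Fin n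
  let Tι : DL1 ω →L[ℂ] (ι → Lp ℂ 2 (volume : Measure (Rn n))) :=
    ContinuousLinearMap.pi fun α => T α.1 α.2
  set A' := ∑ j ∈ Finset.range (N + 1), A j with hA'def
  set B' := ∑ j ∈ Finset.range (N + n + 1 + 1), B j * Fintype.card (Fin j → Fin n) with hB'def
  have hA'0 : 0 ≤ A' := Finset.sum_nonneg fun j _ => hA j
  have hnorms (χ : DL1 ω) :
      DL1.norms (expWeight n k) (N + n + 1) (DL1.ofLE (expWeight_le_succ k) χ) ≤ B' * ‖Tι χ‖ := by
    refine (DL1.norms_le_sum _ _).trans ?_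
    rw [hB'def, Finset.sum_mul]
    refine Finset.sum_le_sum fun j hj => (hB' j k _ (hT j) χ).trans ?_
    rw [mul_assoc]
    refine mul_le_mul_of_nonneg_left ?_ (hB j)
    calc _ ≤ ∑ _v : Fin j → Fin n, ‖Tι χ‖ := by
          refine Finset.sum_le_sum fun v _ => ?_
          exact norm_le_pi_norm (Tι χ) ⟨⟨j, Finset.mem_range.1 hj⟩, v⟩
      _ = _ := by simp
  -- The weight with `k` controls `e^{k|t|}` in the Sobolev inequality; passing to `L²` by `hnorms`
  -- uses up the step from `k` to `k + 1`.
  have hbound (χ : compactlySupported ω) :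
      ‖complexify ω f χ‖ ≤ 2 * C * (A' * B') * ‖Tι χ.1‖ := by
    rw [mul_assoc]
    refine norm_complexify_le hf χ _ fun j hj t => ?_
    have h1 : Real.exp (k * ‖t‖) ≤ expWeight n k t := by
      change _ ≤ Real.exp _
      gcongr
      exact norm_le_sqrt_one_add_norm_sq t
    calc _ ≤ expWeight n k t * ‖iteratedFDeriv ℝ j (DL1.ofLE (expWeight_le_succ k) χ.1) t‖ := by
          rw [DL1.coe_ofLE]; gcongr
      _ ≤ A j * DL1.norms (expWeight n k) (j + n + 1) (DL1.ofLE (expWeight_le_succ k) χ.1) := hA' j _ t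
      _ ≤ A' * (B' * ‖Tι χ.1‖) := by
          gcongr
          · exact Finset.single_le_sum (f := A) (fun j _ => hA j)
              (Finset.mem_range.2 (Nat.lt_succ_of_le hj))
          · exact (DL1.norms_mono _ (by omega) _).trans (hnorms χ.1)
      _ = _ := by ring
  -- The extension is made from the compactly supported functions to a finite power of `L²`, so the
  -- functional obtained on `D_{L¹_ω}` has the form `G ∘ Tι` and splits into components.
  obtain ⟨G, hG⟩ := exists_factor_of_norm_le (Tι.toLinearMap ∘ₗ (compactlySupported ω).subtype)
    (complexify ω f) _ hbound
  refine ⟨G.comp Tι, ?_, fun φ => ?_⟩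
  · classical
    have hsum : G.comp Tι = ∑ α : ι,
        (G.comp (ContinuousLinearMap.single ℂ (fun _ : ι => Lp ℂ 2 (volume : Measure (Rn n))) α)).comp
          (T α.1 α.2) := by
      ext χ
      have h := congrArg G (Finset.univ_sum_single (Tι χ)).symm
      rw [map_sum] at h
      simpa [Tι] using h
    rw [hsum]
    exact sum_mem_closure_testFunctionals _ _ fun α _ =>
      comp_mem_closure_testFunctionals (contDiff_expWeight n (k + 1)) (hT α.1 α.2) _
  · obtain ⟨h, h'⟩ := complexify_ofTest (ω := ω) f φ
    rw [← h', ← hG]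
    rfl

theorem exists_mem_BDotDual_of_isVonNBounded {f : 𝓓'((⊤ : Opens (Rn n)), ℂ)} {s : ℝ}
    (hf : IsVonNBounded ℝ (Set.range fun h : Rn n => Real.exp (-s * ‖h‖) • translate (-h) f)) :
    ∃ ω : Weight n, f ∈ BDotDual ω := by
  obtain ⟨N, k, C, -, h⟩ := exists_norm_apply_le_of_isVonNBounded hf
  exact ⟨_, mem_BDotDual_of_norm_apply_le h⟩

end ExpType

/-! ### The cycle of inclusions is closed. -/

theorem mainTheorem9 (n : ℕ) :
    (ExpType.K1Dual n = ⋃ ω : ExpType.Weight n, ExpType.BDual ω) ∧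
    (ExpType.K1Dual n = ⋃ ω : ExpType.Weight n, ExpType.BDotDual ω) ∧
    ∀ f : 𝓓'((⊤ : Opens (ExpType.Rn n)), ℂ),
      f ∈ ExpType.K1Dual n ↔
        ∃ s : ℝ, IsVonNBounded ℝ
          (Set.range fun h : ExpType.Rn n =>
            Real.exp (-s * ‖h‖) • ExpType.translate (-h) f) := by
  have h1 {f : 𝓓'((⊤ : Opens (ExpType.Rn n)), ℂ)} (hf : f ∈ ExpType.K1Dual n) :
      ∃ ω : ExpType.Weight n, f ∈ ExpType.BDotDual ω := by
    obtain ⟨s, hs⟩ := ExpType.isVonNBounded_of_mem_K1Dual hf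
    exact ExpType.exists_mem_BDotDual_of_isVonNBounded hs
  have h2 {f : 𝓓'((⊤ : Opens (ExpType.Rn n)), ℂ)} {ω : ExpType.Weight n}
      (hf : f ∈ ExpType.BDotDual ω) : f ∈ ExpType.BDual ω :=
    ExpType.BDotDual_subset_BDual ω hf
  have h3 {f : 𝓓'((⊤ : Opens (ExpType.Rn n)), ℂ)} {ω : ExpType.Weight n}
      (hf : f ∈ ExpType.BDual ω) : f ∈ ExpType.K1Dual n :=
    ExpType.BDual_subset_K1Dual ω hf
  refine ⟨?_, ?_, fun f => ⟨ExpType.isVonNBounded_of_mem_K1Dual, ?_⟩⟩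
  · ext f
    rw [Set.mem_iUnion]
    exact ⟨fun hf => (h1 hf).imp fun _ => h2, fun ⟨_, hf⟩ => h3 hf⟩
  · ext f
    rw [Set.mem_iUnion]
    exact ⟨h1, fun ⟨_, hf⟩ => h3 (h2 hf)⟩
  · rintro ⟨s, hs⟩
    obtain ⟨ω, hω⟩ := ExpType.exists_mem_BDotDual_of_isVonNBounded hs
    exact h3 (h2 hω)
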